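/- Let $E$ be a real Euclidean vector space of dimension $2n$, $G\subset \mathrm{O}(E)$ a finite reflection group with set of reflections $\mathcal S$, and $c:\mathcal S\to\mathbb R$ a real-valued function that is constant on $G$-conjugacy classes. For $s\in\mathcal S$ let $\alpha_s\in E$ and $a_s\in E^*$ be $-1$ eigenvectors of $s$. Let $H_c=H_c(G,E)$ be the rational Cherednik algebra, i.e. the quotient of $T(E_{\mathbb C}\oplus E_{\mathbb C}^*)\rtimes\mathbb C[G]$ by the relations $[\xi,\eta]=0$, $[x,y]=0$ and $$[\xi,x]=\langle x,\xi\rangle-2\sum_{s\in\mathcal S}\frac{\langle x,\alpha_s\rangle\langle a_s,\xi\rangle}{\langle a_s,\alpha_s\rangle}\,c(s)\,s\qquad(\xi,\eta\in E,\ x,y\in E^*).$$ Let $*$ be the conjugate-linear anti-involution of $H_c$ that exchanges $E$ and $E^*$ through the Euclidean structure and sends $g$ to $g^{-1}$ for $g\in G$. For an irreducible representation $\tau$ of $G$ on a complex vector space $V(\tau)$, let $M_c(\tau)$ be the standard module, i.e. the $H_c$-module induced from the representation $V(\tau)$ of the subalgebra generated by $G$ and $E$, with $E$ acting by zero. Let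 $M_c(\tau)_k$ be the span of the vectors $x_1\cdots x_k\otimes v$ with $x_i\in E^*$, $v\in V(\tau)$. Let $J\in\mathrm{SO}(E)$ with $J^T=-J$ be a complex structure, and let $\xi_1,\dots,\xi_n,\eta_1,\dots,\eta_n$ be an orthonormal basis of $E$ with $J\xi_j=-\eta_j$, $J\eta_j=\xi_j$, and dual basis $x_1,\dots,x_n,y_1,\dots,y_n$. Put $$E_+=\tfrac12\sum_j(x_j^2+y_j^2),\quad E_-=-\tfrac12\sum_j(\xi_j^2+\eta_j^2),\quad H=\sum_j(x_j\xi_j+y_j\eta_j)+n-\sum_{s\in\mathcal S}c(s)s,\quad Z_0=i\sum_j(x_j\eta_j-y_j\xi_j).$$ These elements give a realisation in $H_c$ of the complexification $\mathfrak{gl}(2,\mathbb C)$ of $\mathfrak u(1,1)$ ($[H,E_\pm]=\pm2E_\pm$, $[E_+,E_-]=H$, $Z_0$ central), where the elements $X$ of the real form $\mathfrak u(1,1)$ satisfy $X^*=-X$. Let $\mathcal V$ be the centralizer of $\{E_+,E_-,H,Z_0\}$ in $H_c$. Let $\mathcal H_c(\tau)_k=M_c(\tau)_k\cap\ker E_-$,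 let $\Sigma_c(\tau)_k$ be the set of eigenvalues of $Z_0$ on $\mathcal H_c(\tau)_k$, and let $\mathcal H_c(\tau)_{k,\lambda}$ be the $\lambda$-eigenspace of $Z_0$ in $\mathcal H_c(\tau)_k$. Assume that $M_c(\tau)$ is irreducible as an $H_c$-module and unitarisable, i.e. that it carries a positive-definite Hermitian form $\beta$ with $\beta(hp,q)=\beta(p,h^*q)$ for all $h\in H_c$ and $p,q\in M_c(\tau)$. Then $\sum_{s}c(s)s$ acts on $V(\tau)$ by a scalar $N_c(\tau)$, each $\mathcal H_c(\tau)_{k,\lambda}$ is a $\mathcal V$-submodule of $M_c(\tau)$, and there is a joint $(\mathcal V,\mathfrak u(1,1))$-decomposition $$M_c(\tau)\;\cong\;\bigoplus_{k\ge0}\ \bigoplus_{\lambda\in\Sigma_c(\tau)_k}\mathcal H_c(\tau)_{k,\lambda}\otimes L_{\mathfrak u(1,1)}\big(k+n-N_c(\tau),\lambda\big),$$ i.e. a linear isomorphism that intertwines the action of $\mathcal V$ on the first tensor factors and that of $\mathfrak u(1,1)$ on the second ones with their actions on $M_c(\tau)$, and under which $p\otimes\ell_0$, with $\ell_0$ the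 lowest weight vector, corresponds to $p\in\mathcal H_c(\tau)_{k,\lambda}$. Here $L_{\mathfrak u(1,1)}(\mu,\nu)$ is the irreducible lowest weight $\mathfrak u(1,1)$-module of $(H,Z_0)$-lowest weight $(\mu,\nu)$. -/

import Mathlib

open scoped TensorProduct Matrix Polynomial DirectSum ComplexConjugate

set_option linter.unusedSectionVars false

noncomputable section

namespace Cherednik

/-! ### Reflection groups and parameters -/

section Reflections

variable {E : Type*} [NormedAddCommGroup E] [InnerProductSpace ℝ E] [FiniteDimensional ℝ E]

/-- An orthogonal transformation is a reflection if it is the orthogonal reflection in the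
hyperplane orthogonal to some nonzero vector. -/
def IsReflection (s : E ≃ₗᵢ[ℝ] E) : Prop :=
  ∃ α : E, α ≠ 0 ∧ s = (ℝ ∙ α)ᗮ.reflection

/-- The set `𝒮` of reflections belonging to the group `G`. -/
abbrev Refl (G : Subgroup (E ≃ₗᵢ[ℝ] E)) : Type _ :=
  {s : G // IsReflection (s : E ≃ₗᵢ[ℝ] E)}

/-- A group of orthogonal transformations that is generated by its reflections; a finite such group
is a finite reflection group. -/
def IsReflectionGroup (G : Subgroup (E ≃ₗᵢ[ℝ] E)) : Prop :=
  Subgroup.closure {s | s ∈ G ∧ IsReflection s} = G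

/-- The parameter takes the same value on conjugate reflections. -/
def IsClassParameter (G : Subgroup (E ≃ₗᵢ[ℝ] E)) (c : Refl G → ℝ) : Prop :=
  ∀ s t : Refl G, IsConj s.1 t.1 → c s = c t

instance (G : Subgroup (E ≃ₗᵢ[ℝ] E)) [Finite G] : Fintype (Refl G) := Fintype.ofFinite _

/-- A chosen `-1` eigenvector `α_s ∈ E` of the reflection `s`. -/
def root {G : Subgroup (E ≃ₗᵢ[ℝ] E)} (s : Refl G) : E := s.2.choose

/-- The linear form `⟨ξ, ·⟩ ∈ E*`. -/
def flat (ξ : E) : Module.Dual ℝ E := innerₗ E ξ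

/-- The vector of `E` that represents a linear form; the inverse of `flat`. -/
def sharp (x : Module.Dual ℝ E) : E :=
  (InnerProductSpace.toDual ℝ E).symm (LinearMap.toContinuousLinearMap x)

/-- A `-1` eigenvector `a_s ∈ E*` of the reflection `s`. -/
def coroot {G : Subgroup (E ≃ₗᵢ[ℝ] E)} (s : Refl G) : Module.Dual ℝ E := flat (root s)

/-- The contragredient action of `g` on `E*`. -/
def contra (g : E ≃ₗᵢ[ℝ] E) (x : Module.Dual ℝ E) : Module.Dual ℝ E :=
  x ∘ₗ (g⁻¹ : E ≃ₗᵢ[ℝ] E).toLinearEquiv.toLinearMap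

theorem sharp_inner (x : Module.Dual ℝ E) (ξ : E) : inner ℝ (sharp x) ξ = x ξ := by
  simp [sharp]

theorem sharp_flat (ξ : E) : sharp (flat ξ) = ξ := by
  refine ext_inner_right ℝ fun v => ?_
  rw [sharp_inner]; rfl

theorem flat_sharp (x : Module.Dual ℝ E) : flat (sharp x) = x :=
  LinearMap.ext fun ξ => sharp_inner x ξ

theorem flat_add (ξ η : E) : flat (ξ + η) = flat ξ + flat η := map_add _ _ _

theorem flat_smul (r : ℝ) (ξ : E) : flat (r • ξ) = r • flat ξ := map_smul _ _ _

theorem sharp_add (x y : Module.Dual ℝ E) : sharp (x + y) = sharp x + sharp y := by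
  rw [← sharp_flat (sharp x + sharp y), flat_add, flat_sharp, flat_sharp]

theorem sharp_smul (r : ℝ) (x : Module.Dual ℝ E) : sharp (r • x) = r • sharp x := by
  rw [← sharp_flat (r • sharp x), flat_smul, flat_sharp]

theorem contra_flat (g : E ≃ₗᵢ[ℝ] E) (ξ : E) : contra g (flat ξ) = flat (g ξ) := by
  ext v
  change inner ℝ ξ (g⁻¹ v) = inner ℝ (g ξ) v
  rw [← LinearIsometryEquiv.inner_map_map g ξ (g⁻¹ v)]
  congr 1
  exact g.apply_symm_apply v

theorem sharp_contra (g : E ≃ₗᵢ[ℝ] E) (x : Module.Dual ℝ E) :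
    sharp (contra g x) = g (sharp x) := by
  rw [← sharp_flat (g (sharp x)), ← contra_flat, flat_sharp]

end Reflections

/-! ### The rational Cherednik algebra -/

section Algebra

variable {E : Type*} [NormedAddCommGroup E] [InnerProductSpace ℝ E] [FiniteDimensional ℝ E]

/-- Generators of the algebra: vectors of `E`, covectors in `E*`, and elements of `G`. -/
inductive Gen (G : Subgroup (E ≃ₗᵢ[ℝ] E)) : Type _
  | vec (ξ : E) : Gen G
  | cov (x : Module.Dual ℝ E) : Gen G
  | grp (g : G) : Gen G

/-- The free complex algebra on the generators. -/
abbrev Free (G : Subgroup (E ≃ₗᵢ[ℝ] E)) : Type _ := FreeAlgebra ℂ (Gen G)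

/-- The letter of the free algebra that belongs to `ξ ∈ E`. -/
abbrev fvec (G : Subgroup (E ≃ₗᵢ[ℝ] E)) (ξ : E) : Free G := FreeAlgebra.ι ℂ (Gen.vec ξ)

/-- The letter of the free algebra that belongs to `x ∈ E*`. -/
abbrev fcov (G : Subgroup (E ≃ₗᵢ[ℝ] E)) (x : Module.Dual ℝ E) : Free G :=
  FreeAlgebra.ι ℂ (Gen.cov x)

/-- The letter of the free algebra that belongs to `g ∈ G`. -/
abbrev fgrp {G : Subgroup (E ≃ₗᵢ[ℝ] E)} (g : G) : Free G := FreeAlgebra.ι ℂ (Gen.grp g)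

/-- The defining relations. The first group presents `T(E_ℂ ⊕ E*_ℂ) ⋊ ℂ[G]`: the letters of `E` and
of `E*` are real-linear, those of `G` multiply as in `G`, and `g X = (g · X) g`. The last three are
the relations of the rational Cherednik algebra. -/
inductive Rel (G : Subgroup (E ≃ₗᵢ[ℝ] E)) [Finite G] (c : Refl G → ℝ) : Free G → Free G → Prop
  | vec_add (ξ η : E) : Rel G c (fvec G (ξ + η)) (fvec G ξ + fvec G η)
  | vec_smul (r : ℝ) (ξ : E) : Rel G c (fvec G (r • ξ)) ((r : ℂ) • fvec G ξ)
  | cov_add (x y : Module.Dual ℝ E) : Rel G c (fcov G (x + y)) (fcov G x + fcov G y)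
  | cov_smul (r : ℝ) (x : Module.Dual ℝ E) : Rel G c (fcov G (r • x)) ((r : ℂ) • fcov G x)
  | grp_one : Rel G c (fgrp (1 : G)) 1
  | grp_mul (g h : G) : Rel G c (fgrp (g * h)) (fgrp g * fgrp h)
  | grp_vec (g : G) (ξ : E) :
      Rel G c (fgrp g * fvec G ξ) (fvec G ((g : E ≃ₗᵢ[ℝ] E) ξ) * fgrp g)
  | grp_cov (g : G) (x : Module.Dual ℝ E) :
      Rel G c (fgrp g * fcov G x) (fcov G (contra (g : E ≃ₗᵢ[ℝ] E) x) * fgrp g)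
  | vec_comm (ξ η : E) : Rel G c (fvec G ξ * fvec G η) (fvec G η * fvec G ξ)
  | cov_comm (x y : Module.Dual ℝ E) : Rel G c (fcov G x * fcov G y) (fcov G y * fcov G x)
  | vec_cov (ξ : E) (x : Module.Dual ℝ E) :
      Rel G c (fvec G ξ * fcov G x - fcov G x * fvec G ξ)
        (algebraMap ℂ (Free G) (x ξ : ℝ) - (2 : ℂ) • ∑ s : Refl G,
          ((x (root s) * coroot s ξ / coroot s (root s) * c s : ℝ) : ℂ) • fgrp s.1)

/-- The rational Cherednik algebra `H_c(G, E)` at a real-valued parameter `c`. -/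
def RCA (G : Subgroup (E ≃ₗᵢ[ℝ] E)) [Finite G] (c : Refl G → ℝ) : Type _ :=
  RingQuot (Rel G c)

variable (G : Subgroup (E ≃ₗᵢ[ℝ] E)) [Finite G] (c : Refl G → ℝ)

instance : Ring (RCA G c) := inferInstanceAs (Ring (RingQuot (Rel G c)))

instance : Algebra ℂ (RCA G c) := inferInstanceAs (Algebra ℂ (RingQuot (Rel G c)))

/-- The commutator bracket of `H_c(G, E)`. -/
instance : LieRing (RCA G c) := LieRing.ofAssociativeRing

/-- The quotient map from the free algebra. -/
def mk : Free G →ₐ[ℂ] RCA G c := RingQuot.mkAlgHom ℂ (Rel G c)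

theorem mk_surjective : Function.Surjective (mk G c) := RingQuot.mkAlgHom_surjective ℂ (Rel G c)

/-- The element of `H_c(G, E)` given by `ξ ∈ E`. -/
def vec (ξ : E) : RCA G c := mk G c (fvec G ξ)

/-- The element of `H_c(G, E)` given by `x ∈ E*`. -/
def cov (x : Module.Dual ℝ E) : RCA G c := mk G c (fcov G x)

/-- The element of `H_c(G, E)` given by `g ∈ G`. -/
def grp (g : G) : RCA G c := mk G c (fgrp g)

/-! #### The conjugate-linear anti-involution `*` -/

/-- The image of a generator under `*`. -/
def starGen : Gen G → RCA G c
  | .vec ξ => cov G c (flat ξ)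
  | .cov x => vec G c (sharp x)
  | .grp g => grp G c g⁻¹

/-- The opposite algebra of `H_c(G, E)` with scalars acting through complex conjugation. -/
abbrev conjOppAlgebra : Algebra ℂ (RCA G c)ᵐᵒᵖ :=
  ((algebraMap ℂ (RCA G c)ᵐᵒᵖ).comp (starRingEnd ℂ)).toAlgebra'
    (fun z h => Algebra.commutes (starRingEnd ℂ z) h)

/-- `*` on the free algebra. -/
def starFree : Free G →+* (RCA G c)ᵐᵒᵖ :=
  letI := conjOppAlgebra G c
  (FreeAlgebra.lift ℂ (fun a : Gen G => MulOpposite.op (starGen G c a))).toRingHom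

theorem starFree_ι (a : Gen G) :
    starFree G c (FreeAlgebra.ι ℂ a) = MulOpposite.op (starGen G c a) := by
  let := conjOppAlgebra G c
  exact FreeAlgebra.lift_ι_apply (R := ℂ) (fun a : Gen G => MulOpposite.op (starGen G c a)) a

theorem starFree_algebraMap (z : ℂ) :
    starFree G c (algebraMap ℂ (Free G) z) = algebraMap ℂ (RCA G c)ᵐᵒᵖ (conj z) := by
  let := conjOppAlgebra G c
  exact (FreeAlgebra.lift ℂ (fun a : Gen G => MulOpposite.op (starGen G c a))).commutes z

theorem starFree_smul (z : ℂ) (h : Free G) :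
    starFree G c (z • h) = conj z • starFree G c h := by
  rw [Algebra.smul_def, map_mul, starFree_algebraMap, ← Algebra.smul_def]

variable {G c}

theorem mk_rel {a b : Free G} (h : Rel G c a b) : mk G c a = mk G c b :=
  RingQuot.mkAlgHom_rel ℂ h

theorem vec_add (ξ η : E) : vec G c (ξ + η) = vec G c ξ + vec G c η := by
  simpa [vec] using mk_rel (Rel.vec_add (c := c) ξ η)

theorem vec_smul (r : ℝ) (ξ : E) : vec G c (r • ξ) = (r : ℂ) • vec G c ξ := by
  simpa only [vec, map_smul] using mk_rel (Rel.vec_smul (c := c) r ξ)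

theorem cov_add (x y : Module.Dual ℝ E) : cov G c (x + y) = cov G c x + cov G c y := by
  simpa [cov] using mk_rel (Rel.cov_add (c := c) x y)

theorem cov_smul (r : ℝ) (x : Module.Dual ℝ E) : cov G c (r • x) = (r : ℂ) • cov G c x := by
  simpa only [cov, map_smul] using mk_rel (Rel.cov_smul (c := c) r x)

theorem grp_one : grp G c 1 = 1 := by
  simpa [grp] using mk_rel (Rel.grp_one (G := G) (c := c))

theorem grp_mul (g h : G) : grp G c (g * h) = grp G c g * grp G c h := by
  simpa [grp] using mk_rel (Rel.grp_mul (c := c) g h)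

theorem grp_vec (g : G) (ξ : E) :
    grp G c g * vec G c ξ = vec G c ((g : E ≃ₗᵢ[ℝ] E) ξ) * grp G c g := by
  simpa [grp, vec] using mk_rel (Rel.grp_vec (c := c) g ξ)

theorem grp_cov (g : G) (x : Module.Dual ℝ E) :
    grp G c g * cov G c x = cov G c (contra (g : E ≃ₗᵢ[ℝ] E) x) * grp G c g := by
  simpa [grp, cov] using mk_rel (Rel.grp_cov (c := c) g x)

theorem vec_comm (ξ η : E) : vec G c ξ * vec G c η = vec G c η * vec G c ξ := by
  simpa [vec] using mk_rel (Rel.vec_comm (c := c) ξ η)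

theorem cov_comm (x y : Module.Dual ℝ E) : cov G c x * cov G c y = cov G c y * cov G c x := by
  simpa [cov] using mk_rel (Rel.cov_comm (c := c) x y)

theorem vec_cov (ξ : E) (x : Module.Dual ℝ E) :
    vec G c ξ * cov G c x - cov G c x * vec G c ξ =
      algebraMap ℂ (RCA G c) (x ξ : ℝ) - (2 : ℂ) • ∑ s : Refl G,
        ((x (root s) * coroot s ξ / coroot s (root s) * c s : ℝ) : ℂ) • grp G c s.1 := by
  have := mk_rel (Rel.vec_cov (c := c) ξ x)
  simp only [map_sub, map_mul, map_smul, map_sum, AlgHom.commutes] at this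
  exact this

theorem refl_inv (s : Refl G) : (s.1 : G)⁻¹ = s.1 := by
  obtain ⟨s, α, -, hα⟩ := s
  refine Subtype.ext ?_
  change (s : E ≃ₗᵢ[ℝ] E)⁻¹ = s
  rw [hα]
  exact Submodule.reflection_symm

theorem starFree_rel ⦃a b : Free G⦄ (h : Rel G c a b) : starFree G c a = starFree G c b := by
  apply MulOpposite.unop_injective
  induction h with
  | vec_add ξ η => simp [starFree_ι, starGen, flat_add, cov_add]
  | vec_smul r ξ => rw [starFree_smul]; simp [starFree_ι, starGen, flat_smul, cov_smul]
  | cov_add x y => simp [starFree_ι, starGen, sharp_add, vec_add]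
  | cov_smul r x => rw [starFree_smul]; simp [starFree_ι, starGen, sharp_smul, vec_smul]
  | grp_one => simp [starFree_ι, starGen, grp_one]
  | grp_mul g h => simp [starFree_ι, starGen, grp_mul]
  | grp_vec g ξ =>
    simp only [map_mul, starFree_ι, starGen, MulOpposite.unop_mul, MulOpposite.unop_op]
    rw [grp_cov, ← contra_flat]
    congr 2
    ext v
    simp [contra]
  | grp_cov g x =>
    simp only [map_mul, starFree_ι, starGen, MulOpposite.unop_mul, MulOpposite.unop_op]
    rw [grp_vec, sharp_contra]
    congr 2
    simp
  | vec_comm ξ η => simp [starFree_ι, starGen, cov_comm (flat η)]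
  | cov_comm x y => simp [starFree_ι, starGen, vec_comm (sharp y)]
  | vec_cov ξ x =>
    simp only [map_sub, map_mul, map_sum, starFree_ι, starGen, starFree_smul, starFree_algebraMap,
      MulOpposite.unop_sub, MulOpposite.unop_mul, MulOpposite.unop_smul,
      MulOpposite.unop_op, Complex.conj_ofReal, refl_inv]
    rw [vec_cov]
    have h1 : flat ξ (sharp x) = x ξ := by
      rw [← sharp_inner x ξ]; exact real_inner_comm _ _
    have h2 : ∀ s : Refl G, flat ξ (root s) * coroot s (sharp x) = x (root s) * coroot s ξ := by
      intro s
      have e1 : coroot s (sharp x) = x (root s) := by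
        rw [← sharp_inner x]; exact real_inner_comm _ _
      have e2 : flat ξ (root s) = coroot s ξ := real_inner_comm _ _
      rw [e1, e2, mul_comm]
    simp only [h1, h2]
    have h3 : (starRingEnd ℂ) 2 = 2 := map_ofNat _ 2
    simp [MulOpposite.algebraMap_apply, h3]

variable (G c)

/-- `*` as a ring homomorphism into the opposite ring. -/
def starHom : RCA G c →+* (RCA G c)ᵐᵒᵖ := RingQuot.lift ⟨starFree G c, starFree_rel⟩

variable {G c}

/-- The conjugate-linear anti-involution `*` of `H_c(G, E)`, which sends `ξ ∈ E` to
`⟨ξ, ·⟩ ∈ E*`, a covector to the vector representing it, and `g` to `g⁻¹` (so `s* = s` for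
reflections `s`). -/
def adj (h : RCA G c) : RCA G c := (starHom G c h).unop

theorem starHom_mk (a : Free G) : starHom G c (mk G c a) = starFree G c a := by
  have : mk G c a = RingQuot.mkRingHom (Rel G c) a := by
    rw [← RingQuot.mkAlgHom_coe ℂ (Rel G c)]; rfl
  rw [this]
  exact RingQuot.lift_mkRingHom_apply _ _ a

theorem adj_vec (ξ : E) : adj (vec G c ξ) = cov G c (flat ξ) := by
  simp [adj, vec, starHom_mk, starFree_ι, starGen]

theorem adj_cov (x : Module.Dual ℝ E) : adj (cov G c x) = vec G c (sharp x) := by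
  simp [adj, cov, starHom_mk, starFree_ι, starGen]

theorem adj_grp (g : G) : adj (grp G c g) = grp G c g⁻¹ := by
  simp [adj, grp, starHom_mk, starFree_ι, starGen]

theorem adj_add (a b : RCA G c) : adj (a + b) = adj a + adj b := by simp [adj]

theorem adj_mul (a b : RCA G c) : adj (a * b) = adj b * adj a := by simp [adj]

theorem adj_smul (z : ℂ) (a : RCA G c) : adj (z • a) = conj z • adj a := by
  obtain ⟨a, rfl⟩ := mk_surjective G c a
  rw [← map_smul, adj, starHom_mk, starFree_smul, adj, starHom_mk, MulOpposite.unop_smul]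

end Algebra

/-! ### Standard modules -/

section Standard

variable {E : Type*} [NormedAddCommGroup E] [InnerProductSpace ℝ E] [FiniteDimensional ℝ E]
variable {G : Subgroup (E ≃ₗᵢ[ℝ] E)} [Finite G] (c : Refl G → ℝ)
variable {V : Type*} [AddCommGroup V] [Module ℂ V] (τ : Representation ℂ G V)

/-- The `H_c(G, E)`-submodule of `H_c(G, E) ⊗_ℂ V(τ)` generated by the balancing relations of the
induced module: `g ⊗ v = 1 ⊗ τ(g) v` and `ξ ⊗ v = 0`. -/
def stdRel : Submodule (RCA G c) (RCA G c ⊗[ℂ] V) :=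
  Submodule.span (RCA G c)
    ({m | ∃ (g : G) (v : V), m = grp G c g ⊗ₜ[ℂ] v - 1 ⊗ₜ[ℂ] τ g v} ∪
      {m | ∃ (ξ : E) (v : V), m = vec G c ξ ⊗ₜ[ℂ] v})

/-- The standard module `M_c(τ)`: the `H_c(G, E)`-module induced from the representation `V(τ)` of
the subalgebra generated by `G` and `E`, on which `E` acts by zero. -/
abbrev StdModule : Type _ := (RCA G c ⊗[ℂ] V) ⧸ stdRel c τ

/-- The vector `h ⊗ v` of the standard module. -/
def stdMk (h : RCA G c) (v : V) : StdModule c τ := (stdRel c τ).mkQ (h ⊗ₜ[ℂ] v)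

/-- The operator by which an element of `H_c(G, E)` acts on `M_c(τ)`. -/
abbrev act (h : RCA G c) : Module.End ℂ (StdModule c τ) := Algebra.lsmul ℂ ℂ (StdModule c τ) h

/-- The degree-`k` part `M_c(τ)_k`: the span of the vectors `x₁ ⋯ x_k ⊗ v` with `x_i ∈ E*`. -/
def degPart (k : ℕ) : Submodule ℂ (StdModule c τ) :=
  Submodule.span ℂ {m | ∃ (x : Fin k → Module.Dual ℝ E) (v : V),
    m = stdMk c τ (List.ofFn fun i => cov G c (x i)).prod v}

/-- `M_c(τ)` is unitarisable with respect to `*`: it carries a positive-definite Hermitian form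
(linear in the first variable) that is contravariant. -/
def IsUnitarisable : Prop :=
  ∃ β : StdModule c τ →ₗ[ℂ] StdModule c τ →ₗ⋆[ℂ] ℂ,
    (∀ p q, β q p = conj (β p q)) ∧
    (∀ p, p ≠ 0 → 0 < (β p p).re) ∧
    ∀ (h : RCA G c) (p q : StdModule c τ), β (h • p) q = β p (adj h • q)

end Standard

/-! ### Complex structures and the elements `E₊, E₋, H, Z₀` -/

section Triple

variable {E : Type*} [NormedAddCommGroup E] [InnerProductSpace ℝ E] [FiniteDimensional ℝ E]

/-- A complex structure compatible with the Euclidean structure: `J ∈ SO(E)` with `Jᵀ = -J`. -/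
def IsComplexStructure (J : E ≃ₗᵢ[ℝ] E) : Prop :=
  LinearMap.det (J.toLinearEquiv : E →ₗ[ℝ] E) = 1 ∧ ∀ ξ η : E, inner ℝ (J ξ) η = -inner ℝ ξ (J η)

/-- An orthonormal basis `ξ_j = b (inl j)`, `η_j = b (inr j)` is adapted to `J` if
`J ξ_j = -η_j` and `J η_j = ξ_j`. -/
def IsAdapted {n : ℕ} (J : E ≃ₗᵢ[ℝ] E) (b : OrthonormalBasis (Fin n ⊕ Fin n) ℝ E) : Prop :=
  ∀ j : Fin n, J (b (.inl j)) = -b (.inr j) ∧ J (b (.inr j)) = b (.inl j)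

variable (G : Subgroup (E ≃ₗᵢ[ℝ] E)) [Finite G] (c : Refl G → ℝ)
variable {n : ℕ} (b : OrthonormalBasis (Fin n ⊕ Fin n) ℝ E)

/-- `ξ_j ∈ E` as an element of `H_c(G, E)`. -/
def xi (j : Fin n) : RCA G c := vec G c (b (.inl j))

/-- `η_j ∈ E` as an element of `H_c(G, E)`. -/
def eta (j : Fin n) : RCA G c := vec G c (b (.inr j))

/-- The dual coordinate `x_j ∈ E*` as an element of `H_c(G, E)`. -/
def xx (j : Fin n) : RCA G c := cov G c (b.toBasis.coord (.inl j))

/-- The dual coordinate `y_j ∈ E*` as an element of `H_c(G, E)`. -/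
def yy (j : Fin n) : RCA G c := cov G c (b.toBasis.coord (.inr j))

/-- `σ = ∑ c(s) s`, as an element of the group algebra inside `H_c(G, E)`. -/
def sigma : RCA G c := ∑ s : Refl G, (c s : ℂ) • grp G c s.1

/-- `E₊ = ½ ∑ (x_j² + y_j²)`. -/
def Eplus : RCA G c := (1 / 2 : ℂ) • ∑ j, (xx G c b j ^ 2 + yy G c b j ^ 2)

/-- `E₋ = -½ ∑ (ξ_j² + η_j²)`. -/
def Eminus : RCA G c := (-(1 / 2) : ℂ) • ∑ j, (xi G c b j ^ 2 + eta G c b j ^ 2)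

/-- `H = ∑ (x_j ξ_j + y_j η_j) + n - σ`. -/
def Hel : RCA G c :=
  ∑ j, (xx G c b j * xi G c b j + yy G c b j * eta G c b j) + algebraMap ℂ (RCA G c) n - sigma G c

/-- `Z₀ = i ∑ (x_j η_j - y_j ξ_j)`. -/
def Zel : RCA G c :=
  Complex.I • ∑ j, (xx G c b j * eta G c b j - yy G c b j * xi G c b j)

/-- The algebra `𝒱`: the centralizer of the Lie algebra spanned by `E₊, E₋, H, Z₀` in
`H_c(G, E)`. -/
def centralizerV : Subalgebra ℂ (RCA G c) :=
  Subalgebra.centralizer ℂ {Eplus G c b, Eminus G c b, Hel G c b, Zel G c b}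

variable {G} {V : Type*} [AddCommGroup V] [Module ℂ V] (τ : Representation ℂ G V)

/-- The harmonics `ℋ_c(τ)_k` of degree `k`: the kernel of `E₋` on the degree-`k` part. -/
def harm (k : ℕ) : Submodule ℂ (StdModule c τ) :=
  degPart c τ k ⊓ LinearMap.ker (act c τ (Eminus G c b))

/-- `ℋ_c(τ)_{k,lam}`: the `lam`-eigenspace of `Z₀` inside `ℋ_c(τ)_k`. -/
def harmEig (k : ℕ) (lam : ℂ) : Submodule ℂ (StdModule c τ) :=
  harm c b τ k ⊓ Module.End.eigenspace (act c τ (Zel G c b)) lam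

/-- `Σ_c(τ)_k`: the set of eigenvalues of `Z₀` on `ℋ_c(τ)_k`. -/
def spec (k : ℕ) : Set ℂ := {lam | harmEig c b τ k lam ≠ ⊥}

/-- The pairs `(k, lam)` with `k ≥ 0` and `lam ∈ Σ_c(τ)_k`. -/
abbrev SpecIdx : Type := Σ k : ℕ, spec c b τ k

end Triple

/-! ### The Lie algebra `𝔲(1,1)` and its irreducible lowest weight modules -/

section LowestWeight

/-- `𝔤𝔩(2, ℂ)`, the complexification of `𝔲(1,1)`. A representation of `𝔲(1,1)` on a complex vector
space is the same as a complex-linear representation of `𝔤𝔩(2, ℂ)`. -/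
abbrev GL2 : Type := Matrix (Fin 2) (Fin 2) ℂ

/-- The commutator bracket of `𝔤𝔩(2, ℂ)`. -/
instance : LieRing GL2 := LieRing.ofAssociativeRing

/-- The basis vector `E₊` of `𝔤𝔩(2, ℂ)`. -/
def gE : GL2 := !![0, 1; 0, 0]

/-- The basis vector `E₋` of `𝔤𝔩(2, ℂ)`. -/
def gF : GL2 := !![0, 0; 1, 0]

/-- The basis vector `H` of `𝔤𝔩(2, ℂ)`. -/
def gH : GL2 := !![1, 0; 0, -1]

/-- The central basis vector `Z₀` of `𝔤𝔩(2, ℂ)`. -/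
def gZ : GL2 := 1

/-- The real form `𝔲(1,1)`: the matrices `X` with `Xᴴ D + D X = 0`, where `D = diag(1, -1)`. -/
def u11 : LieSubalgebra ℝ GL2 where
  carrier := {X | Xᴴ * gH + gH * X = 0}
  add_mem' {X Y} hX hY := by
    simp only [Set.mem_ofPred_eq] at *
    rw [Matrix.conjTranspose_add, add_mul, mul_add, add_add_add_comm, hX, hY, add_zero]
  zero_mem' := by simp
  smul_mem' r X hX := by
    simp only [Set.mem_ofPred_eq] at *
    rw [Matrix.conjTranspose_smul, smul_mul_assoc, mul_smul_comm, star_trivial, ← smul_add, hX,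
      smul_zero]
  lie_mem' {X Y} hX hY := by
    change Xᴴ * gH + gH * X = 0 at hX
    change Yᴴ * gH + gH * Y = 0 at hY
    have hX' : Xᴴ * gH = -(gH * X) := eq_neg_of_add_eq_zero_left hX
    have hY' : Yᴴ * gH = -(gH * Y) := eq_neg_of_add_eq_zero_left hY
    change (⁅X, Y⁆ : GL2)ᴴ * gH + gH * ⁅X, Y⁆ = 0
    rw [Ring.lie_def, Matrix.conjTranspose_sub, Matrix.conjTranspose_mul, Matrix.conjTranspose_mul,
      sub_mul, mul_assoc, mul_assoc, hX', hY', mul_neg, mul_neg, ← mul_assoc, ← mul_assoc, hX', hY']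
    noncomm_ring

/-- The complex vector space `ℂ[t]` with the action of `𝔤𝔩(2, ℂ)` by
`H = mu + 2 t d/dt`, `E₊ = mu t + t² d/dt`, `E₋ = -d/dt`, `Z₀ = nu`. -/
def PolyModel (_mu _nu : ℂ) : Type := ℂ[X]

variable (mu nu : ℂ)

instance : AddCommGroup (PolyModel mu nu) := inferInstanceAs (AddCommGroup ℂ[X])

instance : Module ℂ (PolyModel mu nu) := inferInstanceAs (Module ℂ ℂ[X])

/-- The action of a matrix on the polynomial model. -/
def polyAct (A : GL2) (p : ℂ[X]) : ℂ[X] :=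
  Polynomial.C ((A 0 0 - A 1 1) / 2) *
      (Polynomial.C mu * p + 2 * Polynomial.X * Polynomial.derivative p) +
    Polynomial.C (A 0 1) *
      (Polynomial.C mu * Polynomial.X * p + Polynomial.X ^ 2 * Polynomial.derivative p) -
    Polynomial.C (A 1 0) * Polynomial.derivative p +
    Polynomial.C ((A 0 0 + A 1 1) / 2) * (Polynomial.C nu * p)

theorem polyAct_lie (A B : GL2) (p : ℂ[X]) :
    polyAct mu nu A (polyAct mu nu B p) =
      polyAct mu nu ⁅A, B⁆ p + polyAct mu nu B (polyAct mu nu A p) := by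
  have h : ∀ i j, ⁅A, B⁆ i j = A i 0 * B 0 j + A i 1 * B 1 j - (B i 0 * A 0 j + B i 1 * A 1 j) := by
    intro i j
    change (A * B - B * A) i j = _
    simp [Matrix.mul_apply, Fin.sum_univ_two]
  have h1 : (⁅A, B⁆ 0 0 - ⁅A, B⁆ 1 1) / 2 = A 0 1 * B 1 0 - B 0 1 * A 1 0 := by
    rw [h, h]; ring
  have h2 : (⁅A, B⁆ 0 0 + ⁅A, B⁆ 1 1) / 2 = 0 := by
    rw [h, h]; ring
  have h3 : ⁅A, B⁆ 0 1 =
      ((A 0 0 - A 1 1) / 2) * B 0 1 + ((A 0 0 - A 1 1) / 2) * B 0 1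
        - ((B 0 0 - B 1 1) / 2 * A 0 1 + (B 0 0 - B 1 1) / 2 * A 0 1) := by
    rw [h]; ring
  have h4 : ⁅A, B⁆ 1 0 =
      ((B 0 0 - B 1 1) / 2) * A 1 0 + ((B 0 0 - B 1 1) / 2) * A 1 0
        - ((A 0 0 - A 1 1) / 2 * B 1 0 + (A 0 0 - A 1 1) / 2 * B 1 0) := by
    rw [h]; ring
  simp only [polyAct, h1, h2, h3, h4]
  generalize (A 0 0 - A 1 1) / 2 = u, (B 0 0 - B 1 1) / 2 = u', (A 0 0 + A 1 1) / 2 = w,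
    (B 0 0 + B 1 1) / 2 = w'
  simp only [Polynomial.C_mul, Polynomial.C_sub, Polynomial.C_add, Polynomial.C_0,
    Polynomial.derivative_mul, Polynomial.derivative_add, Polynomial.derivative_sub,
    Polynomial.derivative_C, Polynomial.derivative_X, Polynomial.derivative_X_sq,
    Polynomial.derivative_ofNat]
  simp only [show (Polynomial.C 2 : ℂ[X]) = 2 from rfl]
  ring

theorem polyAct_add (A : GL2) (p q : ℂ[X]) :
    polyAct mu nu A (p + q) = polyAct mu nu A p + polyAct mu nu A q := by
  simp only [polyAct, Polynomial.derivative_add]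
  ring

theorem polyAct_smul (r : ℂ) (A : GL2) (p : ℂ[X]) :
    polyAct mu nu A (r • p) = r • polyAct mu nu A p := by
  simp only [polyAct, Polynomial.smul_eq_C_mul, Polynomial.derivative_C_mul]
  ring

theorem add_polyAct (A B : GL2) (p : ℂ[X]) :
    polyAct mu nu (A + B) p = polyAct mu nu A p + polyAct mu nu B p := by
  simp only [polyAct, Matrix.add_apply, div_eq_mul_inv, Polynomial.C_mul, Polynomial.C_sub,
    Polynomial.C_add]
  ring

theorem smul_polyAct (r : ℂ) (A : GL2) (p : ℂ[X]) :
    polyAct mu nu (r • A) p = r • polyAct mu nu A p := by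
  simp only [polyAct, Matrix.smul_apply, smul_eq_mul, div_eq_mul_inv, Polynomial.C_mul,
    Polynomial.C_sub, Polynomial.C_add, Polynomial.smul_eq_C_mul]
  ring

instance : LieRingModule GL2 (PolyModel mu nu) where
  bracket A p := polyAct mu nu A p
  add_lie A B p := add_polyAct mu nu A B p
  lie_add A p q := polyAct_add mu nu A p q
  leibniz_lie A B p := polyAct_lie mu nu A B p

instance : LieModule ℂ GL2 (PolyModel mu nu) where
  smul_lie r A p := smul_polyAct mu nu r A p
  lie_smul r A p := polyAct_smul mu nu r A p

theorem lie_def (A : GL2) (p : PolyModel mu nu) : ⁅A, p⁆ = polyAct mu nu A p := rfl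

/-- The constant polynomial `1`. -/
def polyOne : PolyModel mu nu := (1 : ℂ[X])

/-- The irreducible lowest weight module `L(mu, nu)` of `𝔲(1,1)` with lowest weight `(mu, nu)` for
`(H, Z₀)`, realised as the submodule of the polynomial model generated by `1`. -/
abbrev LowestWeight : Type := LieSubmodule.lieSpan ℂ GL2 {polyOne mu nu}

/-- The lowest weight vector of `L(mu, nu)`. -/
def lowVec : LowestWeight mu nu := ⟨polyOne mu nu, LieSubmodule.subset_lieSpan rfl⟩

theorem lowVec_ne_zero : lowVec mu nu ≠ 0 := fun h =>
  one_ne_zero (α := ℂ[X]) (congrArg Subtype.val h)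

theorem gF_polyAct (p : ℂ[X]) : polyAct mu nu gF p = -Polynomial.derivative p := by
  simp [polyAct, gF]

theorem lowVec_weight :
    ⁅gF, lowVec mu nu⁆ = 0 ∧ ⁅gH, lowVec mu nu⁆ = mu • lowVec mu nu ∧
      ⁅gZ, lowVec mu nu⁆ = nu • lowVec mu nu := by
  refine ⟨Subtype.ext ?_, Subtype.ext ?_, Subtype.ext ?_⟩
  · change polyAct mu nu gF 1 = 0
    simp [gF_polyAct]
  · change polyAct mu nu gH 1 = mu • (1 : ℂ[X])
    simp [polyAct, gH, Polynomial.smul_eq_C_mul]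
  · change polyAct mu nu gZ 1 = nu • (1 : ℂ[X])
    simp [polyAct, gZ, Polynomial.smul_eq_C_mul]

theorem lowVec_mem (N : LieSubmodule ℂ GL2 (LowestWeight mu nu)) (k : ℕ) :
    ∀ (p : LowestWeight mu nu) (q : ℂ[X]), p.1 = q → p ∈ N → q ≠ 0 → q.natDegree = k →
      lowVec mu nu ∈ N := by
  induction k using Nat.strong_induction_on with
  | _ k ih =>
    intro p q hpq hp h0 hk
    rcases Nat.eq_zero_or_pos k with hk0 | hpos
    · obtain ⟨a, ha⟩ := Polynomial.natDegree_eq_zero.mp (hk.trans hk0)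
      have ha0 : a ≠ 0 := by
        intro h
        exact h0 (by rw [← ha, h, Polynomial.C_0])
      have e : (1 : ℂ[X]) = a⁻¹ • q := by
        rw [← ha, Polynomial.smul_C, smul_eq_mul, inv_mul_cancel₀ ha0, Polynomial.C_1]
      have : lowVec mu nu = a⁻¹ • p := by
        refine Subtype.ext (e.trans ?_)
        rw [← hpq]
        rfl
      rw [this]
      exact N.smul_mem _ hp
    · have hd : (Polynomial.derivative q).natDegree = k - 1 := by
        rw [Polynomial.natDegree_derivative, hk]
      have hd0 : Polynomial.derivative q ≠ 0 := fun h => by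
        have := Polynomial.derivative_eq_zero.mp h
        omega
      refine ih (k - 1) (by omega) ⁅gF, p⁆ (-Polynomial.derivative q) ?_ (N.lie_mem hp)
        (neg_ne_zero.mpr hd0) (by rw [Polynomial.natDegree_neg, hd])
      rw [← hpq]
      exact gF_polyAct mu nu p.1

theorem lowestWeight_irreducible : LieModule.IsIrreducible ℂ GL2 (LowestWeight mu nu) := by
  have : Nontrivial (LowestWeight mu nu) := ⟨_, _, lowVec_ne_zero mu nu⟩
  refine LieModule.IsIrreducible.mk fun N hN => ?_
  have hN' : ∃ p ∈ N, p ≠ 0 := by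
    by_contra! h
    exact hN ((LieSubmodule.eq_bot_iff N).mpr h)
  obtain ⟨p, hp, h0⟩ := hN'
  have h1 := lowVec_mem mu nu N _ p p.1 rfl hp (fun h => h0 (Subtype.ext h)) rfl
  have h2 : LieSubmodule.lieSpan ℂ GL2 {polyOne mu nu} ≤
      N.map (LieSubmodule.lieSpan ℂ GL2 {polyOne mu nu}).incl := by
    rw [LieSubmodule.lieSpan_le, Set.singleton_subset_iff]
    exact (LieSubmodule.mem_map _).mpr ⟨_, h1, rfl⟩
  refine eq_top_iff.mpr fun q _ => ?_
  obtain ⟨q', hq', e⟩ := (LieSubmodule.mem_map _).mp (h2 q.2)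
  rwa [← Subtype.ext (a1 := q') (a2 := q) e]

end LowestWeight

/-! ### The decomposed space -/

section Decomposition

variable {E : Type*} [NormedAddCommGroup E] [InnerProductSpace ℝ E] [FiniteDimensional ℝ E]
variable {G : Subgroup (E ≃ₗᵢ[ℝ] E)} [Finite G] (c : Refl G → ℝ)
variable {n : ℕ} (b : OrthonormalBasis (Fin n ⊕ Fin n) ℝ E)
variable {V : Type*} [AddCommGroup V] [Module ℂ V] (τ : Representation ℂ G V) (N : ℂ)

/-- The summand `ℋ_c(τ)_{k,lam} ⊗ L(k + n - N, lam)`. -/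
abbrev Summand (i : SpecIdx c b τ) : Type _ :=
  harmEig c b τ i.1 i.2 ⊗[ℂ] LowestWeight ((i.1 : ℂ) + n - N) i.2

/-- The direct sum of the spaces `ℋ_c(τ)_{k,lam} ⊗ L(k + n - N, lam)` over `k ≥ 0` and
`lam ∈ Σ_c(τ)_k`. -/
abbrev DecompSpace : Type _ := ⨁ i : SpecIdx c b τ, Summand c b τ N i

open Classical in
/-- The vector `p ⊗ l` of the summand with index `i`. -/
def pureVec (i : SpecIdx c b τ) (p : harmEig c b τ i.1 i.2)
    (l : LowestWeight ((i.1 : ℂ) + n - N) i.2) : DecompSpace c b τ N :=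
  DirectSum.lof ℂ (SpecIdx c b τ) (Summand c b τ N) i (p ⊗ₜ[ℂ] l)

end Decomposition

end Cherednik

end

/-! The decomposition is the Fischer decomposition into harmonics, driven by adjointness. In $H_c$
one has $E_+^*=-E_-$, $H^*=H$ and $Z_0^*=Z_0$, and these four elements satisfy the relations of
$\mathfrak{gl}(2)$. For the positive form $\beta$ the orthogonal complement of $E_+M_k$ inside the
finite-dimensional space $M_{k+2}$ is therefore killed by $E_-$, so $M_{k+2}=E_+M_k+\mathcal
H_{k+2}$. By induction on the degree, the harmonics and their images under powers of $E_+$ span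
$M_c(\tau)$. Since $Z_0$ is self-adjoint and preserves each $\mathcal H_k$, it is diagonalisable
there (`le_iSup_inf_eigenspace`), which gives surjectivity (`decompMap_surjective`).

A harmonic $p$ of $H$-weight $\mu=k+n-N$ is a lowest weight vector. Sending $t^j$ to
$E_+^jp/(\mu(\mu+1)\cdots(\mu+j-1))$ intertwines the polynomial model with the action on $M_c(\tau)$
(`raise_lie`). It also commutes with everything that commutes with $E_+$, in particular with
$\mathcal V$ (`raise_comm`).

Injectivity is a norm computation. Distinct joint eigenspaces of the self-adjoint $H$ and $Z_0$ are
orthogonal, and so are different powers of $E_+$ applied to harmonics of equal weight. Moreover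
$\beta(E_+^jp,E_+^jw)=j!\,\mu(\mu+1)\cdots(\mu+j-1)\,\beta(p,w)$ (`form_pow_pow`). Pairing with
$E_+^jw$ thus reads off the $j$-th coefficient in a single summand (`form_decompMap`).

Positivity forces $\mu\ge0$, because $\|E_+p\|^2=\mu\|p\|^2$ (`weight_nonneg`). The factors above
vanish only when $\mu=0$. In that case $E_+p=0$ and $L(0,\lambda)$ consists of constants, so powers
$j\ge1$ never matter. -/

noncomputable section

namespace Cherednik

/-! ### Commutation relations in the Cherednik algebra -/

section AlgebraRelations

variable {E : Type*} [NormedAddCommGroup E] [InnerProductSpace ℝ E] [FiniteDimensional ℝ E]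

section Roots

variable {G : Subgroup (E ≃ₗᵢ[ℝ] E)}

theorem root_ne_zero (s : Refl G) : root s ≠ 0 := s.2.choose_spec.1

theorem coe_eq_reflection (s : Refl G) :
    ((s.1 : G) : E ≃ₗᵢ[ℝ] E) = (ℝ ∙ root s)ᗮ.reflection := s.2.choose_spec.2

theorem refl_apply_root (s : Refl G) : ((s.1 : G) : E ≃ₗᵢ[ℝ] E) (root s) = -root s := by
  rw [coe_eq_reflection]
  exact Submodule.reflection_orthogonalComplement_singleton_eq_neg _

theorem coroot_root_ne_zero (s : Refl G) : coroot s (root s) ≠ 0 :=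
  (real_inner_self_pos.mpr (root_ne_zero s)).ne'

theorem reflection_orthogonal_singleton_apply (α ξ : E) : (ℝ ∙ α)ᗮ.reflection ξ =
    ξ - (2 * (inner ℝ α ξ / inner ℝ α α : ℝ)) • α := by
  rw [Submodule.reflection_orthogonal_apply, Submodule.reflection_singleton_apply,
    neg_sub, real_inner_self_eq_norm_sq, ← smul_smul, ofNat_smul_eq_nsmul ℝ 2]
  rfl

theorem refl_apply (s : Refl G) (ξ : E) :
    ((s.1 : G) : E ≃ₗᵢ[ℝ] E) ξ = ξ - (2 * (coroot s ξ / coroot s (root s))) • root s := by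
  rw [coe_eq_reflection, reflection_orthogonal_singleton_apply]
  rfl

theorem contra_refl [Finite G] (s : Refl G) (x : Module.Dual ℝ E) :
    contra ((s.1 : G) : E ≃ₗᵢ[ℝ] E) x
      = x - (2 * (x (root s) / coroot s (root s))) • coroot s := by
  ext v
  have h : (((s.1 : G) : E ≃ₗᵢ[ℝ] E)⁻¹ : E ≃ₗᵢ[ℝ] E) = ((s.1 : G) : E ≃ₗᵢ[ℝ] E) := by
    rw [← Subgroup.coe_inv, refl_inv]
  change x (((((s.1 : G) : E ≃ₗᵢ[ℝ] E)⁻¹ : E ≃ₗᵢ[ℝ] E)) v) = _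
  rw [h, refl_apply]
  simp only [map_sub, map_smul, LinearMap.sub_apply, LinearMap.smul_apply, smul_eq_mul]
  ring

end Roots

variable {G : Subgroup (E ≃ₗᵢ[ℝ] E)} [Finite G] {c : Refl G → ℝ}

theorem vec_sum {ι : Type*} (s : Finset ι) (f : ι → E) :
    vec G c (∑ i ∈ s, f i) = ∑ i ∈ s, vec G c (f i) :=
  map_sum (AddMonoidHom.mk' (vec G c) vec_add) f s

theorem cov_sum {ι : Type*} (s : Finset ι) (f : ι → Module.Dual ℝ E) :
    cov G c (∑ i ∈ s, f i) = ∑ i ∈ s, cov G c (f i) :=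
  map_sum (AddMonoidHom.mk' (cov G c) cov_add) f s

theorem vec_neg (ξ : E) : vec G c (-ξ) = -vec G c ξ :=
  map_neg (AddMonoidHom.mk' (vec G c) vec_add) ξ

theorem cov_sub (x y : Module.Dual ℝ E) : cov G c (x - y) = cov G c x - cov G c y :=
  map_sub (AddMonoidHom.mk' (cov G c) cov_add) x y

variable (G c)

/-- `∑ c(s) ⟨x, α_s⟩ / ⟨a_s, α_s⟩ a_s s`, the correction term of the commutation relations. -/
def reflTerm (x : Module.Dual ℝ E) : RCA G c :=
  ∑ s : Refl G, ((x (root s) / coroot s (root s) * c s : ℝ) : ℂ) • (cov G c (coroot s) * grp G c s.1)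

variable {G c}

/-- Moving $s$ past $x$ replaces $x$ by its reflection, and the difference is a multiple of $a_s$.
The same term occurs in `euler_cov`, and the two cancel in `Hel_cov`. -/
theorem sigma_cov (x : Module.Dual ℝ E) :
    sigma G c * cov G c x - cov G c x * sigma G c = -(2 : ℂ) • reflTerm G c x := by
  simp only [sigma, reflTerm, Finset.sum_mul, Finset.mul_sum, Finset.smul_sum,
    ← Finset.sum_sub_distrib]
  refine Finset.sum_congr rfl fun s _ => ?_
  rw [smul_mul_assoc, grp_cov, contra_refl, cov_sub, cov_smul, mul_smul_comm, ← smul_sub, sub_mul,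
    sub_sub_cancel_left, smul_mul_assoc, smul_neg, smul_smul, smul_smul, ← neg_smul]
  congr 1
  push_cast
  ring

section Basis

variable {ι : Type*} [Fintype ι] (b : OrthonormalBasis ι ℝ E)

theorem coord_apply' (i : ι) (v : E) : b.toBasis.coord i v = inner ℝ (b i) v := by
  simp [b.repr_apply_apply]

theorem sharp_coord (i : ι) : sharp (b.toBasis.coord i) = b i := by
  refine ext_inner_right ℝ fun v => ?_
  rw [sharp_inner, coord_apply']

theorem flat_basis (i : ι) : flat (b i) = b.toBasis.coord i := by
  rw [← sharp_coord b i, flat_sharp]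

theorem dual_eq_sum (x : Module.Dual ℝ E) : x = ∑ i, x (b i) • b.toBasis.coord i := by
  classical
  refine b.toBasis.ext fun i => ?_
  simp

theorem cov_eq_sum (x : Module.Dual ℝ E) :
    cov G c x = ∑ i, (x (b i) : ℂ) • cov G c (b.toBasis.coord i) := by
  conv_lhs => rw [dual_eq_sum b x, cov_sum]
  simp only [cov_smul]

theorem sum_smul_basis (x : Module.Dual ℝ E) : ∑ i, x (b i) • b i = sharp x := by
  refine ext_inner_right ℝ fun v => ?_
  rw [sharp_inner, sum_inner]
  conv_rhs => rw [dual_eq_sum b x]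
  simp [inner_smul_left, b.repr_apply_apply]

variable (G c)

/-- The Euler element `∑ x_i ξ_i`. -/
def euler : RCA G c := ∑ i, cov G c (b.toBasis.coord i) * vec G c (b i)

/-- The Laplacian `∑ ξ_i²`. -/
def lapl : RCA G c := ∑ i, vec G c (b i) ^ 2

/-- The squared norm `∑ x_i²`. -/
def normSq : RCA G c := ∑ i, cov G c (b.toBasis.coord i) ^ 2

variable {G c}

/-- Covectors commute, so only the commutators $[\xi_i,x]$ contribute. Summing them against the
$x_i$ reassembles $x$ from its coordinates and, in the reflection part, each $a_s$ from its own. -/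
theorem euler_cov (x : Module.Dual ℝ E) :
    euler G c b * cov G c x - cov G c x * euler G c b = cov G c x - (2 : ℂ) • reflTerm G c x := by
  have h1 : euler G c b * cov G c x - cov G c x * euler G c b =
      ∑ i, cov G c (b.toBasis.coord i) * (vec G c (b i) * cov G c x - cov G c x * vec G c (b i)) := by
    simp only [euler, Finset.sum_mul, Finset.mul_sum, ← Finset.sum_sub_distrib, mul_sub,
      ← mul_assoc, cov_comm x]
  rw [h1]
  simp only [vec_cov, mul_sub, Finset.sum_sub_distrib]
  congr 1
  · rw [cov_eq_sum b x]
    refine Finset.sum_congr rfl fun i _ => ?_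
    rw [← Algebra.commutes, ← Algebra.smul_def]
  · simp only [mul_smul_comm, ← Finset.smul_sum, reflTerm, Finset.mul_sum]
    rw [Finset.sum_comm]
    congr 1
    refine Finset.sum_congr rfl fun s _ => ?_
    rw [cov_eq_sum b (coroot s), Finset.sum_mul, Finset.smul_sum]
    refine Finset.sum_congr rfl fun i _ => ?_
    rw [smul_mul_assoc, smul_smul]
    congr 1
    push_cast
    ring

/-- The reflection terms assemble to multiples of $\alpha_s s+s\alpha_s$, which vanish because
$s\alpha_s=-\alpha_s s$. Only the undeformed derivative of the Laplacian survives. -/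
theorem lapl_cov (x : Module.Dual ℝ E) :
    lapl G c b * cov G c x - cov G c x * lapl G c b = (2 : ℂ) • vec G c (sharp x) := by
  have h1 : lapl G c b * cov G c x - cov G c x * lapl G c b =
      ∑ i, (vec G c (b i) * (vec G c (b i) * cov G c x - cov G c x * vec G c (b i)) +
        (vec G c (b i) * cov G c x - cov G c x * vec G c (b i)) * vec G c (b i)) := by
    simp only [lapl, Finset.sum_mul, Finset.mul_sum, ← Finset.sum_sub_distrib]
    refine Finset.sum_congr rfl fun i _ => ?_
    noncomm_ring
  have hs : vec G c (sharp x) = ∑ i, (x (b i) : ℂ) • vec G c (b i) := by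
    rw [← sum_smul_basis b x, vec_sum]
    simp only [vec_smul]
  have hroot : ∀ s : Refl G, ∑ i, (coroot s (b i) : ℂ) • vec G c (b i) = vec G c (root s) := by
    intro s
    rw [← sharp_flat (root s), ← sum_smul_basis b (flat (root s)), vec_sum]
    simp only [vec_smul]
    rfl
  -- The contribution of a single reflection: $\sum_i a_s(\xi_i)\xi_i=\alpha_s$, and $\alpha_s$
  -- anticommutes with $s$.
  have h2 : ∀ s : Refl G, ∑ i, (((x (root s) * coroot s (b i) / coroot s (root s) * c s : ℝ) : ℂ) •
      (vec G c (b i) * grp G c s.1 + grp G c s.1 * vec G c (b i))) = 0 := by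
    intro s
    have e : ∀ i, (((x (root s) * coroot s (b i) / coroot s (root s) * c s : ℝ) : ℂ) •
      (vec G c (b i) * grp G c s.1 + grp G c s.1 * vec G c (b i))) =
      ((x (root s) / coroot s (root s) * c s : ℝ) : ℂ) •
        (((coroot s (b i) : ℂ) • vec G c (b i)) * grp G c s.1 +
          grp G c s.1 * ((coroot s (b i) : ℂ) • vec G c (b i))) := by
      intro i
      rw [smul_mul_assoc, mul_smul_comm, ← smul_add, smul_smul]
      congr 1
      push_cast
      ring
    rw [Finset.sum_congr rfl fun i _ => e i, ← Finset.smul_sum, Finset.sum_add_distrib,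
      ← Finset.sum_mul, ← Finset.mul_sum, hroot, grp_vec, refl_apply_root, vec_neg]
    simp
  rw [h1, hs]
  simp only [vec_cov]
  have h3 : ∀ i, (vec G c (b i) * (algebraMap ℂ (RCA G c) (x (b i) : ℝ) - (2 : ℂ) • ∑ s : Refl G,
        ((x (root s) * coroot s (b i) / coroot s (root s) * c s : ℝ) : ℂ) • grp G c s.1) +
      (algebraMap ℂ (RCA G c) (x (b i) : ℝ) - (2 : ℂ) • ∑ s : Refl G,
        ((x (root s) * coroot s (b i) / coroot s (root s) * c s : ℝ) : ℂ) • grp G c s.1) *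
        vec G c (b i)) = (2 : ℂ) • ((x (b i) : ℂ) • vec G c (b i)) - (2 : ℂ) • ∑ s : Refl G,
      (((x (root s) * coroot s (b i) / coroot s (root s) * c s : ℝ) : ℂ) •
      (vec G c (b i) * grp G c s.1 + grp G c s.1 * vec G c (b i))) := by
    intro i
    rw [mul_sub, sub_mul, ← Algebra.commutes, ← Algebra.smul_def, two_smul ℂ ((x (b i) : ℂ) • _)]
    simp only [smul_add, Finset.sum_add_distrib, mul_smul_comm, smul_mul_assoc, Finset.mul_sum,
      Finset.sum_mul]
    abel
  rw [Finset.sum_congr rfl fun i _ => h3 i, Finset.sum_sub_distrib, ← Finset.smul_sum,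
    ← Finset.smul_sum, Finset.sum_comm, Finset.sum_congr rfl fun s _ => h2 s]
  simp

/-- The trace of the commutation relation. The coefficient of $s$ becomes $\langle
a_s,\alpha_s\rangle/\langle a_s,\alpha_s\rangle=1$; this is where the constant $n$ and the term
$\sigma$ in $H$ come from. -/
theorem sum_vec_cov :
    ∑ i, (vec G c (b i) * cov G c (b.toBasis.coord i) - cov G c (b.toBasis.coord i) * vec G c (b i))
      = algebraMap ℂ (RCA G c) (Fintype.card ι) - (2 : ℂ) • sigma G c := by
  classical
  simp only [vec_cov, Finset.sum_sub_distrib, ← Finset.smul_sum]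
  congr 1
  · rw [← map_sum]
    simp
  · congr 1
    rw [Finset.sum_comm, sigma]
    refine Finset.sum_congr rfl fun s _ => ?_
    rw [← Finset.sum_smul]
    congr 1
    have h : ∑ i, (b.toBasis.coord i (root s)) * coroot s (b i) = coroot s (root s) := by
      conv_rhs => rw [dual_eq_sum b (coroot s)]
      simp [mul_comm]
    rw [← Complex.ofReal_sum]
    rw [← Finset.sum_mul, ← Finset.sum_div, h, div_self (coroot_root_ne_zero s), one_mul]

end Basis

theorem adj_sub (u v : RCA G c) : adj (u - v) = adj u - adj v := by simp [adj]

theorem adj_neg (u : RCA G c) : adj (-u) = -adj u := by simp [adj]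

theorem adj_sum {ι : Type*} (s : Finset ι) (f : ι → RCA G c) :
    adj (∑ i ∈ s, f i) = ∑ i ∈ s, adj (f i) := by simp [adj]

theorem adj_pow (u : RCA G c) (k : ℕ) : adj (u ^ k) = adj u ^ k := by simp [adj]

theorem adj_one : adj (1 : RCA G c) = 1 := by simp [adj]

theorem adj_sigma : adj (sigma G c) = sigma G c := by
  simp only [sigma, adj_sum, adj_smul, adj_grp, refl_inv, Complex.conj_ofReal]

/-! ### The realisation of $\mathfrak{gl}(2,\mathbb C)$ and its compatibility with $*$ -/

section Triple

variable {n : ℕ} (b : OrthonormalBasis (Fin n ⊕ Fin n) ℝ E)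

theorem Eplus_eq : Eplus G c b = (1 / 2 : ℂ) • normSq G c b := by
  simp [Eplus, normSq, Fintype.sum_sum_type, Finset.sum_add_distrib, xx, yy]

theorem Eminus_eq : Eminus G c b = -(1 / 2 : ℂ) • lapl G c b := by
  simp [Eminus, lapl, Fintype.sum_sum_type, Finset.sum_add_distrib, xi, eta]

theorem Hel_eq : Hel G c b = euler G c b + algebraMap ℂ (RCA G c) n - sigma G c := by
  simp [Hel, euler, Fintype.sum_sum_type, Finset.sum_add_distrib, xi, eta, xx, yy]

theorem adj_euler : adj (euler G c b) = euler G c b := by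
  rw [euler, adj_sum]
  simp [adj_mul, adj_vec, adj_cov, flat_basis, sharp_coord]

theorem adj_Eplus : adj (Eplus G c b) = -Eminus G c b := by
  simp only [Eplus_eq, Eminus_eq, normSq, lapl, adj_smul, adj_sum, adj_pow, adj_cov, sharp_coord,
    map_div₀, map_one, map_ofNat, neg_smul, neg_neg]

theorem adj_Eminus : adj (Eminus G c b) = -Eplus G c b := by
  simp only [Eplus_eq, Eminus_eq, normSq, lapl, adj_smul, adj_sum, adj_pow, adj_vec, flat_basis,
    map_div₀, map_one, map_ofNat, adj_neg, neg_smul]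

theorem adj_Hel : adj (Hel G c b) = Hel G c b := by
  rw [Hel_eq, adj_sub, adj_add, adj_euler, adj_sigma, Algebra.algebraMap_eq_smul_one, adj_smul,
    adj_one]
  simp

theorem adj_Zel : adj (Zel G c b) = Zel G c b := by
  simp only [Zel, adj_smul, adj_sum, adj_sub, adj_mul, xx, yy, xi, eta, adj_vec, adj_cov,
    flat_basis, sharp_coord, Complex.conj_I, neg_smul, ← smul_neg, ← Finset.sum_neg_distrib, neg_sub]

theorem Hel_cov (x : Module.Dual ℝ E) :
    Hel G c b * cov G c x - cov G c x * Hel G c b = cov G c x := by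
  have h1 := euler_cov (G := G) (c := c) b x
  have h2 := sigma_cov (G := G) (c := c) x
  rw [Hel_eq, sub_mul, add_mul, mul_sub, mul_add, ← Algebra.commutes]
  rw [show ∀ p q r s t : RCA G c, p + q - r - (s + q - t) = (p - s) - (r - t) by
    intros; abel, h1, h2]
  simp

/-- Applying $*$ to `Hel_cov` gives this, as $H$ is self-adjoint and $*$ exchanges vectors and
covectors. -/
theorem Hel_vec (ξ : E) : Hel G c b * vec G c ξ - vec G c ξ * Hel G c b = -vec G c ξ := by
  have h := congrArg adj (Hel_cov (G := G) (c := c) b (flat ξ))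
  rw [adj_sub, adj_mul, adj_mul, adj_Hel, adj_cov, sharp_flat] at h
  rw [← h, neg_sub, h]

theorem Eminus_cov (x : Module.Dual ℝ E) :
    Eminus G c b * cov G c x - cov G c x * Eminus G c b = -vec G c (sharp x) := by
  rw [Eminus_eq, smul_mul_assoc, mul_smul_comm, ← smul_sub, lapl_cov, smul_smul]
  norm_num

theorem Eminus_vec (ξ : E) : Eminus G c b * vec G c ξ = vec G c ξ * Eminus G c b := by
  refine Commute.smul_left (Commute.sum_left _ _ _ fun j _ => ?_) _
  exact ((show Commute _ _ from vec_comm _ _).pow_left 2).add_left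
    ((show Commute _ _ from vec_comm _ _).pow_left 2)

theorem lie_Hel_Eplus : ⁅Hel G c b, Eplus G c b⁆ = (2 : ℂ) • Eplus G c b := by
  rw [Eplus_eq, lie_smul, smul_comm]
  congr 1
  rw [normSq, lie_sum, Finset.smul_sum]
  refine Finset.sum_congr rfl fun i _ => ?_
  have h := Hel_cov (G := G) (c := c) b (b.toBasis.coord i)
  rw [Ring.lie_def, two_smul]
  set X := cov G c (b.toBasis.coord i)
  calc Hel G c b * X ^ 2 - X ^ 2 * Hel G c b
      = (Hel G c b * X - X * Hel G c b) * X + X * (Hel G c b * X - X * Hel G c b) := by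
        noncomm_ring
    _ = _ := by rw [h, sq]

theorem lie_Hel_Eminus : ⁅Hel G c b, Eminus G c b⁆ = -((2 : ℂ) • Eminus G c b) := by
  have h := congrArg adj (lie_Hel_Eplus (G := G) (c := c) b)
  rw [Ring.lie_def, adj_sub, adj_mul, adj_mul, adj_Hel, adj_Eplus, adj_smul, adj_Eplus,
    map_ofNat, smul_neg] at h
  rw [Ring.lie_def, ← h]
  noncomm_ring

/-- Commuting $E_-$ through $x_i^2$ gives the anticommutator $\xi_ix_i+x_i\xi_i$. Half the sum of
these is the Euler element plus half of the trace in `sum_vec_cov`. -/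
theorem lie_Eplus_Eminus : ⁅Eplus G c b, Eminus G c b⁆ = Hel G c b := by
  have h : ⁅Eplus G c b, Eminus G c b⁆ = (1 / 2 : ℂ) • ∑ i,
      (vec G c (b i) * cov G c (b.toBasis.coord i) + cov G c (b.toBasis.coord i) * vec G c (b i)) := by
    rw [Eplus_eq, smul_lie, normSq, sum_lie]
    congr 1
    refine Finset.sum_congr rfl fun i _ => ?_
    have h := Eminus_cov (G := G) (c := c) b (b.toBasis.coord i)
    rw [sharp_coord] at h
    rw [Ring.lie_def]
    set X := cov G c (b.toBasis.coord i)
    calc X ^ 2 * Eminus G c b - Eminus G c b * X ^ 2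
        = -((Eminus G c b * X - X * Eminus G c b) * X + X * (Eminus G c b * X - X * Eminus G c b)) := by
          noncomm_ring
      _ = _ := by rw [h]; noncomm_ring
  rw [h, Hel_eq]
  have h2 : ∑ i, (vec G c (b i) * cov G c (b.toBasis.coord i) +
      cov G c (b.toBasis.coord i) * vec G c (b i)) = (2 : ℂ) • euler G c b +
        (algebraMap ℂ (RCA G c) (Fintype.card (Fin n ⊕ Fin n)) - (2 : ℂ) • sigma G c) := by
    rw [← sum_vec_cov b, euler, Finset.smul_sum, ← Finset.sum_add_distrib]
    refine Finset.sum_congr rfl fun i _ => ?_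
    rw [two_smul]
    abel
  rw [h2, smul_add, smul_sub, smul_smul, smul_smul, Algebra.algebraMap_eq_smul_one, smul_smul,
    Algebra.algebraMap_eq_smul_one]
  rw [show (1 / 2 : ℂ) * 2 = 1 by norm_num, one_smul, one_smul, add_sub_assoc]
  -- It remains to see that half of $\dim E=2n$ is the constant in $H$.
  congr 3
  rw [Fintype.card_sum, Fintype.card_fin]
  push_cast
  ring

theorem commute_Zel_Hel : Commute (Zel G c b) (Hel G c b) := by
  refine Commute.smul_left (Commute.sum_left _ _ _ fun j _ => ?_) _
  have key : ∀ (x : Module.Dual ℝ E) (ξ : E), Commute (cov G c x * vec G c ξ) (Hel G c b) := by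
    intro x ξ
    have h1 := Hel_cov (G := G) (c := c) b x
    have h2 := Hel_vec (G := G) (c := c) b ξ
    have : cov G c x * vec G c ξ * Hel G c b - Hel G c b * (cov G c x * vec G c ξ) =
      -((Hel G c b * cov G c x - cov G c x * Hel G c b) * vec G c ξ +
        cov G c x * (Hel G c b * vec G c ξ - vec G c ξ * Hel G c b)) := by noncomm_ring
    rw [h1, h2] at this
    exact sub_eq_zero.mp (by rw [this]; noncomm_ring)
  exact (key _ _).sub_left (key _ _)

/-- Commuting $E_-$ with $x_j\eta_j$ and $y_j\xi_j$ leaves $\xi_j\eta_j$ and $\eta_j\xi_j$, which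
cancel. The statement for $E_+$ is the adjoint of this one. -/
theorem commute_Zel_Eminus : Commute (Zel G c b) (Eminus G c b) := by
  refine Commute.smul_left (Commute.sum_left _ _ _ fun j _ => ?_) _
  have key : ∀ (x : Module.Dual ℝ E) (ξ : E), cov G c x * vec G c ξ * Eminus G c b -
      Eminus G c b * (cov G c x * vec G c ξ) = vec G c (sharp x) * vec G c ξ := by
    intro x ξ
    have h1 := Eminus_cov (G := G) (c := c) b x
    have h2 := Eminus_vec (G := G) (c := c) b ξ
    have : cov G c x * vec G c ξ * Eminus G c b - Eminus G c b * (cov G c x * vec G c ξ) =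
      -((Eminus G c b * cov G c x - cov G c x * Eminus G c b) * vec G c ξ) := by
      rw [mul_assoc, ← h2]
      noncomm_ring
    rw [this, h1]
    noncomm_ring
  refine sub_eq_zero.mp ?_
  rw [sub_mul, mul_sub, sub_sub_sub_comm, xx, yy, xi, eta, key, key, sharp_coord, sharp_coord,
    vec_comm, sub_self]

theorem commute_Zel_Eplus : Commute (Zel G c b) (Eplus G c b) := by
  have h := congrArg adj (commute_Zel_Eminus (G := G) (c := c) b).eq
  rw [adj_mul, adj_mul, adj_Zel, adj_Eminus, neg_mul, mul_neg, neg_inj] at h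
  exact h.symm

variable (G c)

/-- The realisation of `𝔤𝔩(2, ℂ)` in `H_c(G, E)`. -/
def gl2Hom : GL2 →ₗ⁅ℂ⁆ RCA G c where
  toFun A := ((A 0 0 - A 1 1) / 2) • Hel G c b + A 0 1 • Eplus G c b + A 1 0 • Eminus G c b +
    ((A 0 0 + A 1 1) / 2) • Zel G c b
  map_add' A B := by
    simp only [Matrix.add_apply]
    module
  map_smul' r A := by
    simp only [Matrix.smul_apply, smul_eq_mul, RingHom.id_apply]
    module
  map_lie' {A B} := by
    have h : ∀ i j, ⁅A, B⁆ i j = A i 0 * B 0 j + A i 1 * B 1 j - (B i 0 * A 0 j + B i 1 * A 1 j) := by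
      intro i j
      change (A * B - B * A) i j = _
      simp [Matrix.mul_apply, Fin.sum_univ_two]
    have hHE := lie_Hel_Eplus (G := G) (c := c) b
    have hHF := lie_Hel_Eminus (G := G) (c := c) b
    have hEF := lie_Eplus_Eminus (G := G) (c := c) b
    have hEH : ⁅Eplus G c b, Hel G c b⁆ = -((2 : ℂ) • Eplus G c b) := by rw [← lie_skew, hHE]
    have hFH : ⁅Eminus G c b, Hel G c b⁆ = (2 : ℂ) • Eminus G c b := by
      rw [← lie_skew, hHF, neg_neg]
    have hFE : ⁅Eminus G c b, Eplus G c b⁆ = -Hel G c b := by rw [← lie_skew, hEF]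
    have hZH := (commute_Zel_Hel (G := G) (c := c) b).lie_eq
    have hZE := (commute_Zel_Eplus (G := G) (c := c) b).lie_eq
    have hZF := (commute_Zel_Eminus (G := G) (c := c) b).lie_eq
    have hHZ := (commute_Zel_Hel (G := G) (c := c) b).symm.lie_eq
    have hEZ := (commute_Zel_Eplus (G := G) (c := c) b).symm.lie_eq
    have hFZ := (commute_Zel_Eminus (G := G) (c := c) b).symm.lie_eq
    simp only [h, add_lie, lie_add, smul_lie, lie_smul, hHE, hHF, hEF, hEH, hFH, hFE, hZH, hZE, hZF,
      hHZ, hEZ, hFZ, lie_self]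
    module

theorem gl2Hom_apply (A : GL2) : gl2Hom G c b A = ((A 0 0 - A 1 1) / 2) • Hel G c b +
    A 0 1 • Eplus G c b + A 1 0 • Eminus G c b + ((A 0 0 + A 1 1) / 2) • Zel G c b := rfl

theorem gl2Hom_gE : gl2Hom G c b gE = Eplus G c b := by simp [gl2Hom_apply, gE]

theorem gl2Hom_gF : gl2Hom G c b gF = Eminus G c b := by simp [gl2Hom_apply, gF]

theorem gl2Hom_gH : gl2Hom G c b gH = Hel G c b := by simp [gl2Hom_apply, gH]

theorem gl2Hom_gZ : gl2Hom G c b gZ = Zel G c b := by simp [gl2Hom_apply, gZ]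

/-- For $X\in\mathfrak u(1,1)$ the diagonal entries are purely imaginary and the off-diagonal ones
are conjugate to each other. This matches $H^*=H$, $Z_0^*=Z_0$ and $E_+^*=-E_-$. -/
theorem adj_gl2Hom {X : GL2} (hX : X ∈ u11) : adj (gl2Hom G c b X) = -gl2Hom G c b X := by
  change Xᴴ * gH + gH * X = 0 at hX
  have h00 := congrFun (congrFun hX 0) 0
  have h01 := congrFun (congrFun hX 0) 1
  have h10 := congrFun (congrFun hX 1) 0
  have h11 := congrFun (congrFun hX 1) 1
  simp only [Matrix.add_apply, Matrix.mul_apply, Fin.sum_univ_two, gH, Matrix.conjTranspose_apply,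
    Matrix.of_apply, Matrix.cons_val_zero, Matrix.cons_val_one, Matrix.cons_val', Matrix.cons_val_fin_one,
    Matrix.zero_apply, mul_zero, mul_one, zero_mul, one_mul, add_zero, zero_add, mul_neg, neg_mul,
    RCLike.star_def] at h00 h01 h10 h11
  have e00 : conj (X 0 0) = -X 0 0 := eq_neg_of_add_eq_zero_left h00
  have e11 : conj (X 1 1) = -X 1 1 := by linear_combination -h11
  have e10 : conj (X 1 0) = X 0 1 := by linear_combination -h01
  have e01 : conj (X 0 1) = X 1 0 := by linear_combination h10
  have h2 : (starRingEnd ℂ) 2 = 2 := map_ofNat _ 2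
  simp only [gl2Hom_apply, adj_add, adj_smul, adj_Hel, adj_Eplus, adj_Eminus, adj_Zel, map_div₀,
    map_sub, map_add, e00, e11, e10, e01, h2]
  module

end Triple

end AlgebraRelations

/-! ### Irreducible representations of a finite group -/

section Irreducible

variable {Γ V : Type*} [Group Γ] [Finite Γ] [AddCommGroup V] [Module ℂ V]

/-- The orbit of a nonzero vector is finite, and its span is invariant, hence everything. -/
theorem finiteDimensional_of_isIrreducible (τ : Representation ℂ Γ V) (hτ : τ.IsIrreducible) :
    FiniteDimensional ℂ V := by
  by_cases hV : ∃ v : V, v ≠ 0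
  · obtain ⟨v, hv⟩ := hV
    let W : Subrepresentation τ :=
      { toSubmodule := Submodule.span ℂ (Set.range fun g => τ g v)
        apply_mem_toSubmodule := by
          intro g w hw
          induction hw using Submodule.span_induction with
          | mem w hw =>
            obtain ⟨h, rfl⟩ := hw
            exact Submodule.subset_span ⟨g * h, by simp⟩
          | zero => simp
          | add _ _ _ _ h1 h2 => rw [map_add]; exact add_mem h1 h2
          | smul z _ _ h => rw [map_smul]; exact Submodule.smul_mem _ z h }
    have hvW : v ∈ W.toSubmodule := Submodule.subset_span ⟨1, by simp⟩
    have hW : W = ⊤ := by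
      refine (IsSimpleOrder.eq_bot_or_eq_top W).resolve_left fun h => hv ?_
      rw [h] at hvW
      exact hvW
    have : Submodule.span ℂ (Set.range fun g => τ g v) = ⊤ :=
      congrArg Subrepresentation.toSubmodule hW
    exact ⟨this ▸ Submodule.fg_span (Set.finite_range _)⟩
  · push Not at hV
    have : Subsingleton V := ⟨fun a b => (hV a).trans (hV b).symm⟩
    infer_instance

/-- Schur's lemma: an eigenspace of an intertwiner is an invariant subspace. -/
theorem exists_scalar_of_isIrreducible (τ : Representation ℂ Γ V) (hτ : τ.IsIrreducible)
    (T : Module.End ℂ V) (hT : ∀ g v, T (τ g v) = τ g (T v)) : ∃ N : ℂ, ∀ v, T v = N • v := by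
  have := finiteDimensional_of_isIrreducible τ hτ
  by_cases hV : Nontrivial V
  · obtain ⟨N, hN⟩ := Module.End.exists_eigenvalue T
    let W : Subrepresentation τ :=
      { toSubmodule := T.eigenspace N
        apply_mem_toSubmodule := by
          intro g w hw
          rw [Module.End.mem_eigenspace_iff] at hw ⊢
          rw [hT, hw, map_smul] }
    have hW : W = ⊤ := by
      refine (IsSimpleOrder.eq_bot_or_eq_top W).resolve_left fun h => hN ?_
      exact congrArg Subrepresentation.toSubmodule h
    have h1 : T.eigenspace N = ⊤ := congrArg Subrepresentation.toSubmodule hW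
    refine ⟨N, fun v => ?_⟩
    rw [← Module.End.mem_eigenspace_iff, h1]
    trivial
  · rw [not_nontrivial_iff_subsingleton] at hV
    exact ⟨0, fun v => Subsingleton.elim _ _⟩

end Irreducible

/-! ### The grading of the standard module -/

section Module

variable {E : Type*} [NormedAddCommGroup E] [InnerProductSpace ℝ E] [FiniteDimensional ℝ E]
variable {G : Subgroup (E ≃ₗᵢ[ℝ] E)} [Finite G] {c : Refl G → ℝ}
variable {V : Type*} [AddCommGroup V] [Module ℂ V] {τ : Representation ℂ G V}

theorem exists_sigma_scalar (hc : IsClassParameter G c) (hτ : τ.IsIrreducible) :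
    ∃ N : ℂ, ∀ v : V, ∑ s : Refl G, (c s : ℂ) • τ s.1 v = N • v := by
  obtain ⟨N, hN⟩ := exists_scalar_of_isIrreducible τ hτ (∑ s : Refl G, (c s : ℂ) • τ s.1) (by
    intro g v
    have hconj : ∀ (g : G) (s : Refl G),
        IsReflection ((g * s.1 * g⁻¹ : G) : E ≃ₗᵢ[ℝ] E) := by
      intro g s
      refine ⟨(g : E ≃ₗᵢ[ℝ] E) (root s), ?_, ?_⟩
      · simpa using root_ne_zero s
      · ext w
        have h1 : ((g * s.1 * g⁻¹ : G) : E ≃ₗᵢ[ℝ] E) w =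
          (g : E ≃ₗᵢ[ℝ] E) ((s.1 : E ≃ₗᵢ[ℝ] E) ((g : E ≃ₗᵢ[ℝ] E).symm w)) := rfl
        have h2 := LinearIsometryEquiv.inner_map_map (g : E ≃ₗᵢ[ℝ] E) (root s)
          ((g : E ≃ₗᵢ[ℝ] E).symm w)
        rw [LinearIsometryEquiv.apply_symm_apply] at h2
        rw [h1, coe_eq_reflection, reflection_orthogonal_singleton_apply,
          reflection_orthogonal_singleton_apply, map_sub, map_smul,
          LinearIsometryEquiv.apply_symm_apply, LinearIsometryEquiv.inner_map_map, h2]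
    -- Conjugation by $g$ permutes the reflections and preserves $c$, so $\sum c(s)s$ commutes with
    -- $g$ after reindexing.
    let e : Refl G → Refl G := fun s => ⟨g * s.1 * g⁻¹, hconj g s⟩
    have he : Function.Bijective e := by
      refine Finite.injective_iff_bijective.mp fun s t h => ?_
      have h' := congrArg Subtype.val h
      exact Subtype.ext (by simpa [e] using h')
    simp only [LinearMap.sum_apply, LinearMap.smul_apply, map_sum, map_smul]
    rw [← he.sum_comp]
    refine Finset.sum_congr rfl fun s _ => ?_
    have h1 : c (e s) = c s := (hc s (e s) (isConj_iff.mpr ⟨g, rfl⟩)).symm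
    rw [h1]
    congr 1
    change τ (g * s.1 * g⁻¹) (τ g v) = τ g (τ s.1 v)
    rw [← Module.End.mul_apply, ← map_mul, ← Module.End.mul_apply, ← map_mul]
    simp)
  exact ⟨N, fun v => by rw [← hN v]; simp [LinearMap.sum_apply]⟩

theorem smul_stdMk (h h' : RCA G c) (v : V) : h • stdMk c τ h' v = stdMk c τ (h * h') v := rfl

theorem stdMk_eq_smul (h : RCA G c) (v : V) : stdMk c τ h v = h • stdMk c τ 1 v := by
  rw [smul_stdMk, mul_one]

theorem stdMk_add (h : RCA G c) (v w : V) :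
    stdMk c τ h (v + w) = stdMk c τ h v + stdMk c τ h w := by
  simp only [stdMk, TensorProduct.tmul_add, map_add]

theorem stdMk_smul (h : RCA G c) (z : ℂ) (v : V) : stdMk c τ h (z • v) = z • stdMk c τ h v := by
  simp only [stdMk, TensorProduct.tmul_smul]
  rfl

variable (c τ) in
/-- The map `v ↦ 1 ⊗ v`. -/
def oneTensor : V →ₗ[ℂ] StdModule c τ where
  toFun v := stdMk c τ 1 v
  map_add' := stdMk_add 1
  map_smul' := stdMk_smul 1

theorem grp_smul_one (g : G) (v : V) : grp G c g • stdMk c τ 1 v = stdMk c τ 1 (τ g v) := by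
  rw [smul_stdMk, mul_one, ← sub_eq_zero]
  simp only [stdMk]
  rw [← map_sub, Submodule.mkQ_apply, Submodule.Quotient.mk_eq_zero]
  exact Submodule.subset_span (Or.inl ⟨g, v, rfl⟩)

theorem vec_smul_one (ξ : E) (v : V) : vec G c ξ • stdMk c τ 1 v = 0 := by
  rw [smul_stdMk, mul_one]
  simp only [stdMk]
  rw [Submodule.mkQ_apply, Submodule.Quotient.mk_eq_zero]
  exact Submodule.subset_span (Or.inr ⟨ξ, v, rfl⟩)

theorem smul_smul_comm' (h : RCA G c) (z : ℂ) (m : StdModule c τ) : h • z • m = z • h • m :=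
  (act c τ h).map_smul z m

theorem degPart_zero : degPart c τ 0 = LinearMap.range (oneTensor c τ) := by
  refine le_antisymm (Submodule.span_le.mpr ?_) ?_
  · rintro _ ⟨x, v, rfl⟩
    exact ⟨v, by simp [oneTensor]⟩
  · rintro _ ⟨v, rfl⟩
    exact Submodule.subset_span ⟨Fin.elim0, v, by simp [oneTensor]⟩

theorem stdMk_mem_degPart_zero (v : V) : stdMk c τ 1 v ∈ degPart c τ 0 := by
  rw [degPart_zero]
  exact ⟨v, rfl⟩

theorem cov_smul_mem {k : ℕ} {p : StdModule c τ} (hp : p ∈ degPart c τ k) (x : Module.Dual ℝ E) :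
    cov G c x • p ∈ degPart c τ (k + 1) := by
  induction hp using Submodule.span_induction with
  | mem p hp =>
    obtain ⟨y, v, rfl⟩ := hp
    exact Submodule.subset_span ⟨Fin.cons x y, v, by simp [smul_stdMk, List.ofFn_succ]⟩
  | zero => rw [smul_zero]; exact zero_mem _
  | add _ _ _ _ h1 h2 => rw [smul_add]; exact add_mem h1 h2
  | smul z _ _ h => rw [smul_smul_comm']; exact Submodule.smul_mem _ z h

theorem degPart_succ (k : ℕ) : degPart c τ (k + 1) =
    Submodule.span ℂ {m | ∃ (x : Module.Dual ℝ E), ∃ p ∈ degPart c τ k, m = cov G c x • p} := by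
  refine le_antisymm (Submodule.span_le.mpr ?_) (Submodule.span_le.mpr ?_)
  · rintro _ ⟨x, v, rfl⟩
    refine Submodule.subset_span ⟨x 0, _, Submodule.subset_span ⟨Fin.tail x, v, rfl⟩, ?_⟩
    simp [smul_stdMk, List.ofFn_succ, Fin.tail]
  · rintro _ ⟨x, p, hp, rfl⟩
    exact cov_smul_mem hp x

theorem degPart_succ_induction {k : ℕ} {P : Submodule ℂ (StdModule c τ)}
    (h : ∀ (x : Module.Dual ℝ E), ∀ p ∈ degPart c τ k, cov G c x • p ∈ P) :
    degPart c τ (k + 1) ≤ P := by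
  rw [degPart_succ, Submodule.span_le]
  rintro _ ⟨x, p, hp, rfl⟩
  exact h x p hp

theorem grp_smul_mem (g : G) {k : ℕ} : ∀ {p : StdModule c τ}, p ∈ degPart c τ k →
    grp G c g • p ∈ degPart c τ k := by
  induction k with
  | zero =>
    intro p hp
    rw [degPart_zero] at hp
    obtain ⟨v, rfl⟩ := hp
    change grp G c g • stdMk c τ 1 v ∈ _
    rw [grp_smul_one]
    exact stdMk_mem_degPart_zero _
  | succ k ih =>
    intro p hp'
    refine degPart_succ_induction (P := (degPart c τ (k + 1)).comap (act c τ (grp G c g)))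
      ?_ hp'
    intro x p hp
    change grp G c g • cov G c x • p ∈ degPart c τ (k + 1)
    rw [← mul_smul, grp_cov, mul_smul]
    exact cov_smul_mem (ih hp) _

theorem vec_smul_degPart_zero (ξ : E) {p : StdModule c τ} (hp : p ∈ degPart c τ 0) :
    vec G c ξ • p = 0 := by
  rw [degPart_zero] at hp
  obtain ⟨v, rfl⟩ := hp
  exact vec_smul_one ξ v

/-- The commutator $[\xi,x]$ lies in the group algebra, which preserves degree. Moving $\xi$ past
the leading covector therefore reduces the claim to lower degree, down to degree $0$, which $\xi$
kills. -/
theorem vec_smul_mem (ξ : E) {k : ℕ} : ∀ {p : StdModule c τ}, p ∈ degPart c τ (k + 1) →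
    vec G c ξ • p ∈ degPart c τ k := by
  have key : ∀ (k : ℕ) (x : Module.Dual ℝ E) (p : StdModule c τ), p ∈ degPart c τ k →
      cov G c x • vec G c ξ • p ∈ degPart c τ k → vec G c ξ • cov G c x • p ∈ degPart c τ k := by
    intro k x p hp h
    have e : vec G c ξ • cov G c x • p = cov G c x • vec G c ξ • p +
        (vec G c ξ * cov G c x - cov G c x * vec G c ξ) • p := by
      rw [sub_smul, mul_smul, mul_smul]
      abel
    rw [e, vec_cov, sub_smul, algebraMap_smul, smul_assoc, Finset.sum_smul]
    refine add_mem h (sub_mem (Submodule.smul_mem _ _ hp) (Submodule.smul_mem _ _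
      (Submodule.sum_mem _ fun s _ => ?_)))
    rw [smul_assoc]
    exact Submodule.smul_mem _ _ (grp_smul_mem s.1 hp)
  induction k with
  | zero =>
    refine degPart_succ_induction (P := (degPart c τ 0).comap (act c τ (vec G c ξ))) ?_
    intro x p hp
    refine key 0 x p hp ?_
    rw [vec_smul_degPart_zero ξ hp, smul_zero]
    exact zero_mem _
  | succ k ih =>
    refine degPart_succ_induction (P := (degPart c τ (k + 1)).comap (act c τ (vec G c ξ))) ?_
    intro x p hp
    exact key (k + 1) x p hp (cov_smul_mem (ih hp) x)

theorem cov_vec_smul_mem (x : Module.Dual ℝ E) (ξ : E) {k : ℕ} {p : StdModule c τ}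
    (hp : p ∈ degPart c τ k) : (cov G c x * vec G c ξ) • p ∈ degPart c τ k := by
  rw [mul_smul]
  cases k with
  | zero =>
    rw [vec_smul_degPart_zero ξ hp, smul_zero]
    exact zero_mem _
  | succ k => exact cov_smul_mem (vec_smul_mem ξ hp) x

theorem finiteDimensional_degPart [FiniteDimensional ℂ V] (k : ℕ) :
    FiniteDimensional ℂ (degPart c τ k) := by
  induction k with
  | zero =>
    rw [degPart_zero]
    infer_instance
  | succ k ih =>
    let b := stdOrthonormalBasis ℝ E
    have h : degPart c τ (k + 1) ≤
        ⨆ i, (degPart c τ k).map (act c τ (cov G c (b.toBasis.coord i))) := by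
      refine degPart_succ_induction fun x p hp => ?_
      rw [cov_eq_sum b x, Finset.sum_smul]
      refine Submodule.sum_mem _ fun i _ => ?_
      rw [smul_assoc]
      exact Submodule.smul_mem _ _ (Submodule.mem_iSup_of_mem i ⟨p, hp, rfl⟩)
    exact Submodule.finiteDimensional_of_le h

/-- The sum of the graded parts is stable under all generators of the algebra and contains the
vectors $1\otimes v$, which generate the module. -/
theorem iSup_degPart : ⨆ k, degPart c τ k = ⊤ := by
  have stable : ∀ (h : RCA G c), ∀ p ∈ ⨆ k, degPart c τ k, h • p ∈ ⨆ k, degPart c τ k := by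
    intro h
    obtain ⟨a, rfl⟩ := mk_surjective G c h
    induction a using FreeAlgebra.induction with
    | grade0 r =>
      intro p hp
      rw [AlgHom.commutes, algebraMap_smul]
      exact Submodule.smul_mem _ _ hp
    | grade1 x =>
      have aux : ∀ h : RCA G c, (∀ k, ∀ p ∈ degPart c τ k, h • p ∈ ⨆ k, degPart c τ k) →
          ∀ p ∈ ⨆ k, degPart c τ k, h • p ∈ ⨆ k, degPart c τ k := by
        intro h hh p hp
        exact (iSup_le (a := (⨆ k, degPart c τ k).comap (act c τ h)) hh) hp
      cases x with
      | vec ξ =>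
        refine aux (vec G c ξ) fun k p hp => ?_
        cases k with
        | zero => rw [vec_smul_degPart_zero ξ hp]; exact zero_mem _
        | succ k => exact Submodule.mem_iSup_of_mem k (vec_smul_mem ξ hp)
      | cov x =>
        exact aux (cov G c x) fun k p hp => Submodule.mem_iSup_of_mem (k + 1) (cov_smul_mem hp x)
      | grp g =>
        exact aux (grp G c g) fun k p hp => Submodule.mem_iSup_of_mem k (grp_smul_mem g hp)
    | mul a b ha hb =>
      intro p hp
      rw [map_mul, mul_smul]
      exact ha _ (hb _ hp)
    | add a b ha hb =>
      intro p hp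
      rw [map_add, add_smul]
      exact add_mem (ha _ hp) (hb _ hp)
  rw [eq_top_iff]
  rintro m -
  obtain ⟨t, rfl⟩ := (stdRel c τ).mkQ_surjective m
  induction t using TensorProduct.induction_on with
  | zero => rw [map_zero]; exact zero_mem _
  | tmul h v =>
    change stdMk c τ h v ∈ _
    rw [stdMk_eq_smul]
    exact stable h _ (Submodule.mem_iSup_of_mem 0 (stdMk_mem_degPart_zero v))
  | add a b ha hb => rw [map_add]; exact add_mem ha hb

variable {n : ℕ} (b : OrthonormalBasis (Fin n ⊕ Fin n) ℝ E)

theorem Eplus_smul_mem {k : ℕ} {p : StdModule c τ} (hp : p ∈ degPart c τ k) :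
    Eplus G c b • p ∈ degPart c τ (k + 2) := by
  rw [Eplus_eq, smul_assoc, normSq, Finset.sum_smul]
  refine Submodule.smul_mem _ _ (Submodule.sum_mem _ fun i _ => ?_)
  rw [sq, mul_smul]
  exact cov_smul_mem (cov_smul_mem hp _) _

theorem Eminus_smul_mem {k : ℕ} {p : StdModule c τ} (hp : p ∈ degPart c τ (k + 2)) :
    Eminus G c b • p ∈ degPart c τ k := by
  rw [Eminus_eq, smul_assoc, lapl, Finset.sum_smul]
  refine Submodule.smul_mem _ _ (Submodule.sum_mem _ fun i _ => ?_)
  rw [sq, mul_smul]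
  exact vec_smul_mem _ (vec_smul_mem _ hp)

theorem Eminus_smul_eq_zero {k : ℕ} (hk : k < 2) {p : StdModule c τ} (hp : p ∈ degPart c τ k) :
    Eminus G c b • p = 0 := by
  rw [Eminus_eq, smul_assoc, lapl, Finset.sum_smul]
  rw [Finset.sum_eq_zero, smul_zero]
  intro i _
  rw [sq, mul_smul]
  interval_cases k
  · rw [vec_smul_degPart_zero _ hp, smul_zero]
  · exact vec_smul_degPart_zero _ (vec_smul_mem _ hp)

theorem Zel_smul_mem {k : ℕ} {p : StdModule c τ} (hp : p ∈ degPart c τ k) :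
    Zel G c b • p ∈ degPart c τ k := by
  rw [Zel, smul_assoc, Finset.sum_smul]
  refine Submodule.smul_mem _ _ (Submodule.sum_mem _ fun j _ => ?_)
  rw [sub_smul]
  exact sub_mem (cov_vec_smul_mem _ _ hp) (cov_vec_smul_mem _ _ hp)

/-- On $1\otimes v$ the Euler element vanishes and $\sigma$ acts by $N$; each covector then raises
the weight by one. -/
theorem Hel_smul {N : ℂ} (hN : ∀ v : V, ∑ s : Refl G, (c s : ℂ) • τ s.1 v = N • v) {k : ℕ} :
    ∀ {p : StdModule c τ}, p ∈ degPart c τ k → Hel G c b • p = ((k : ℂ) + n - N) • p := by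
  induction k with
  | zero =>
    intro p hp
    rw [degPart_zero] at hp
    obtain ⟨v, rfl⟩ := hp
    change Hel G c b • stdMk c τ 1 v = _ • stdMk c τ 1 v
    have h1 : euler G c b • stdMk c τ 1 v = 0 := by
      rw [euler, Finset.sum_smul]
      exact Finset.sum_eq_zero fun i _ => by rw [mul_smul, vec_smul_one, smul_zero]
    have h2 : sigma G c • stdMk c τ 1 v = N • stdMk c τ 1 v := by
      rw [← stdMk_smul, ← hN]
      change _ = oneTensor c τ _
      rw [map_sum, sigma, Finset.sum_smul]
      refine Finset.sum_congr rfl fun s _ => ?_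
      rw [smul_assoc, grp_smul_one, map_smul]
      rfl
    rw [Hel_eq, sub_smul, add_smul, h1, h2, algebraMap_smul]
    push_cast
    module
  | succ k ih =>
    have : degPart c τ (k + 1) ≤ Module.End.eigenspace (act c τ (Hel G c b))
        (((k + 1 : ℕ) : ℂ) + n - N) := by
      refine degPart_succ_induction fun x p hp => ?_
      rw [Module.End.mem_eigenspace_iff]
      change Hel G c b • cov G c x • p = _
      have h := Hel_cov (G := G) (c := c) b x
      rw [← mul_smul, ← sub_add_cancel (Hel G c b * cov G c x) (cov G c x * Hel G c b), h,
        add_smul, mul_smul, ih hp, smul_smul_comm']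
      generalize cov G c x • p = m
      push_cast
      module
    intro p hp
    exact Module.End.mem_eigenspace_iff.mp (this hp)

/-- The graded parts lie in distinct eigenspaces of $H$ and together span the module, so
independence of eigenspaces leaves no room for more. Describing degree by $H$ is what shows that
$\mathcal V$ preserves it. -/
theorem degPart_eq_eigenspace {N : ℂ}
    (hN : ∀ v : V, ∑ s : Refl G, (c s : ℂ) • τ s.1 v = N • v) (k : ℕ) :
    degPart c τ k = Module.End.eigenspace (act c τ (Hel G c b)) ((k : ℂ) + n - N) := by
  set W : ℂ → Submodule ℂ (StdModule c τ) := Module.End.eigenspace (act c τ (Hel G c b))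
  have hle : ∀ k, degPart c τ k ≤ W ((k : ℂ) + n - N) := fun k p hp =>
    Module.End.mem_eigenspace_iff.mpr (Hel_smul b hN hp)
  refine le_antisymm (hle k) ?_
  have hind := Module.End.eigenspaces_iSupIndep (act c τ (Hel G c b)) ((k : ℂ) + n - N)
  have htop : degPart c τ k ⊔ ⨆ (z : ℂ) (_ : z ≠ (k : ℂ) + n - N), W z = ⊤ := by
    rw [eq_top_iff, ← iSup_degPart (c := c) (τ := τ)]
    refine iSup_le fun j => ?_
    by_cases hj : j = k
    · rw [hj]; exact le_sup_left
    · refine le_sup_of_le_right ((hle j).trans (le_iSup₂_of_le _ ?_ le_rfl))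
      intro h
      apply hj
      have : (j : ℂ) = k := by linear_combination h
      exact_mod_cast this
  intro p hp
  have hp' : p ∈ degPart c τ k ⊔ ⨆ (z : ℂ) (_ : z ≠ (k : ℂ) + n - N), W z := htop ▸ trivial
  obtain ⟨q, hq, r, hr, rfl⟩ := Submodule.mem_sup.mp hp'
  have hrW : r ∈ W ((k : ℂ) + n - N) := by
    have := sub_mem hp (hle k hq)
    rwa [add_sub_cancel_left] at this
  rw [(Submodule.disjoint_def.mp hind) r hrW hr, add_zero]
  exact hq

end Module

/-! ### Positive-definite Hermitian forms -/

section HermitianForm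

variable {M : Type*} [AddCommGroup M] [Module ℂ M] {β : M →ₗ[ℂ] M →ₗ⋆[ℂ] ℂ}

variable (β) in
/-- The inner product space structure of a positive-definite Hermitian form. -/
abbrev hermitianCore (hsymm : ∀ p q, β q p = conj (β p q)) (hpos : ∀ p, p ≠ 0 → 0 < (β p p).re) :
    InnerProductSpace.Core ℂ M where
  -- The form is linear in its first variable, whereas `inner` is conjugate-linear there; hence the
  -- swap.
  inner x y := β y x
  conj_inner_symm x y := (hsymm x y).symm
  re_inner_nonneg x := by
    by_cases hx : x = 0
    · simp [hx]
    · exact (hpos x hx).le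
  add_left x y z := map_add _ _ _
  smul_left x y r := by simp
  definite x hx := by
    by_contra h
    have := hpos x h
    rw [hx] at this
    simp at this

/-- Finite dimension of $W$ supplies the projection; the ambient space need not be complete. -/
theorem exists_mem_orthogonal (hsymm : ∀ p q, β q p = conj (β p q))
    (hpos : ∀ p, p ≠ 0 → 0 < (β p p).re) (W : Submodule ℂ M) [FiniteDimensional ℂ W] (q : M) :
    ∃ w ∈ W, ∀ r ∈ W, β (q - w) r = 0 := by
  let := hermitianCore β hsymm hpos
  let : NormedAddCommGroup M := InnerProductSpace.Core.toNormedAddCommGroup (𝕜 := ℂ)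
  let : InnerProductSpace ℂ M := InnerProductSpace.ofCore _
  obtain ⟨w, hw, h⟩ := Submodule.HasOrthogonalProjection.exists_orthogonal (K := W) q
  exact ⟨w, hw, fun r hr => (Submodule.mem_orthogonal _ _).mp h r hr⟩

theorem iSup_eigenspace_restrict_eq_top {U : Type*} [NormedAddCommGroup U] [InnerProductSpace ℂ U]
    [FiniteDimensional ℂ U] {T : Module.End ℂ U} (hT : T.IsSymmetric) :
    ⨆ z, Module.End.eigenspace T z = ⊤ := by
  rw [← Submodule.orthogonal_eq_bot_iff]
  exact hT.orthogonalComplement_iSup_eigenspaces_eq_bot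

/-- The spectral theorem for the restriction of $T$ to $U$, pushed forward along the inclusion. -/
theorem le_iSup_inf_eigenspace (hsymm : ∀ p q, β q p = conj (β p q))
    (hpos : ∀ p, p ≠ 0 → 0 < (β p p).re) (U : Submodule ℂ M) [FiniteDimensional ℂ U]
    {T : Module.End ℂ M} (hT : ∀ p q, β (T p) q = β p (T q)) (hU : ∀ p ∈ U, T p ∈ U) :
    U ≤ ⨆ z, U ⊓ Module.End.eigenspace T z := by
  have key : ⨆ z, Module.End.eigenspace (T.restrict hU) z = ⊤ := by
    let := hermitianCore β hsymm hpos
    let : NormedAddCommGroup M := InnerProductSpace.Core.toNormedAddCommGroup (𝕜 := ℂ)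
    let : InnerProductSpace ℂ M := InnerProductSpace.ofCore _
    refine iSup_eigenspace_restrict_eq_top (T := T.restrict hU) fun p q => ?_
    exact (hT q.1 p.1).symm
  have h := congrArg (Submodule.map U.subtype) key
  rw [Submodule.map_iSup, Submodule.map_top, Submodule.range_subtype] at h
  conv_lhs => rw [← h]
  refine iSup_mono fun z => ?_
  rintro _ ⟨p, hp, rfl⟩
  refine ⟨p.2, Module.End.mem_eigenspace_iff.mpr ?_⟩
  exact congrArg Subtype.val (Module.End.mem_eigenspace_iff.mp hp)

theorem eq_zero_of_form_self (hpos : ∀ p, p ≠ 0 → 0 < (β p p).re) {p : M} (h : β p p = 0) :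
    p = 0 := by
  by_contra hp
  have := hpos p hp
  rw [h] at this
  simp at this

end HermitianForm

/-! ### Lowest weight vectors -/

section LowestWeightVectors

variable {M : Type*} [AddCommGroup M] [Module ℂ M] {e f h : Module.End ℂ M} {mu mu' : ℂ} {p w : M}

theorem weight_pow (hhe : ∀ m, h (e m) = e (h m) + (2 : ℂ) • e m) (hp : h p = mu • p) (j : ℕ) :
    h ((e ^ j) p) = (mu + 2 * j) • (e ^ j) p := by
  induction j with
  | zero => simpa using hp
  | succ j ih =>
    rw [pow_succ', Module.End.mul_apply, hhe, ih, map_smul]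
    push_cast
    module

theorem lower_pow_succ (hhe : ∀ m, h (e m) = e (h m) + (2 : ℂ) • e m)
    (hef : ∀ m, f (e m) = e (f m) - h m) (hf : f p = 0) (hp : h p = mu • p) (j : ℕ) :
    f ((e ^ (j + 1)) p) = -((j + 1) * (mu + j)) • (e ^ j) p := by
  induction j with
  | zero => simp [hef, hf, hp]
  | succ j ih =>
    rw [pow_succ', Module.End.mul_apply, hef, ih, weight_pow hhe hp, map_smul, pow_succ' e j,
      Module.End.mul_apply]
    push_cast
    module

/-- The factor by which `e ^ j` scales the form on lowest weight vectors of weight `mu`. -/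
def normFactor (mu : ℂ) (j : ℕ) : ℂ := ∏ i ∈ Finset.range j, ((i + 1 : ℂ) * conj (mu + i))

/-- Moving one $e$ across the form turns it into $-f$, which lowers the power on the other side by
one. Unequal exponents end with $f$ applied to a lowest weight vector. The conjugates in
`normFactor` come from the conjugate-linear second variable. -/
theorem form_pow_pow {β : M →ₗ[ℂ] M →ₗ⋆[ℂ] ℂ} (hsymm : ∀ p q, β q p = conj (β p q))
    (hhe : ∀ m, h (e m) = e (h m) + (2 : ℂ) • e m) (hef : ∀ m, f (e m) = e (f m) - h m)
    (hβ : ∀ p q, β (e p) q = -β p (f q)) (hfp : f p = 0) (hfw : f w = 0) (hw : h w = mu • w)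
    (j j' : ℕ) : β ((e ^ j) p) ((e ^ j') w) = if j = j' then normFactor mu j * β p w else 0 := by
  induction j generalizing j' with
  | zero =>
    cases j' with
    | zero => simp [normFactor]
    | succ j' =>
      rw [if_neg (by omega), pow_succ', Module.End.mul_apply, hsymm, hβ, pow_zero,
        Module.End.one_apply, hfp]
      simp
  | succ j ih =>
    rw [pow_succ' e j, Module.End.mul_apply, hβ]
    cases j' with
    | zero => simp [hfw]
    | succ j' =>
      rw [lower_pow_succ hhe hef hfw hw, map_smulₛₗ, ih]
      by_cases hj : j = j'
      · subst hj
        simp only [if_true, normFactor, Finset.prod_range_succ, smul_eq_mul, map_neg, map_mul,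
          map_add, map_natCast, map_one]
        ring
      · simp [hj]

/-- The coefficient `1 / (mu (mu + 1) ⋯ (mu + j - 1))`. -/
def invPoch (mu : ℂ) (j : ℕ) : ℂ := ∏ i ∈ Finset.range j, (mu + i)⁻¹

theorem invPoch_zero (mu : ℂ) : invPoch mu 0 = 1 := by simp [invPoch]

theorem invPoch_succ (mu : ℂ) (j : ℕ) : invPoch mu (j + 1) = invPoch mu j * (mu + j)⁻¹ :=
  Finset.prod_range_succ _ _

variable (e mu) in
/-- The linear map `t ^ j ↦ e ^ j / (mu (mu + 1) ⋯ (mu + j - 1))`. -/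
def raise : ℂ[X] →ₗ[ℂ] Module.End ℂ M :=
  Polynomial.lsum fun j => LinearMap.toSpanSingleton ℂ _ (invPoch mu j • e ^ j)

theorem raise_monomial (j : ℕ) (z : ℂ) :
    raise e mu (Polynomial.monomial j z) = z • invPoch mu j • e ^ j := by
  simp [raise]

theorem raise_one : raise e mu 1 = 1 := by
  rw [← Polynomial.C_1, ← Polynomial.monomial_zero_left, raise_monomial, invPoch_zero]
  simp

theorem raise_C (z : ℂ) : raise e mu (Polynomial.C z) = z • 1 := by
  rw [← Polynomial.monomial_zero_left, raise_monomial, invPoch_zero]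
  simp

theorem raise_comm {g : Module.End ℂ M} (hg : ∀ m, g (e m) = e (g m)) (q : ℂ[X]) (m : M) :
    raise e mu q (g m) = g (raise e mu q m) := by
  have hpow : ∀ (j : ℕ) (m : M), g ((e ^ j) m) = (e ^ j) (g m) := by
    intro j
    induction j with
    | zero => intro m; rfl
    | succ j ih => intro m; rw [pow_succ, Module.End.mul_apply, ih, hg]; rfl
  induction q using Polynomial.induction_on' with
  | add q r hq hr => simp only [map_add, LinearMap.add_apply, hq, hr]
  | monomial j z => simp only [raise_monomial, LinearMap.smul_apply, map_smul, hpow]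

/-- In the model $E_+t^j=(\mu+j)t^{j+1}$, and this factor cancels the new one in the denominator of
`invPoch`. -/
theorem raise_gE (h0 : mu = 0 → e p = 0) (hmu : ∀ j : ℕ, mu + (j + 1 : ℕ) ≠ 0) (q : ℂ[X]) :
    raise e mu (Polynomial.C mu * Polynomial.X * q + Polynomial.X ^ 2 * Polynomial.derivative q) p =
      e (raise e mu q p) := by
  induction q using Polynomial.induction_on' with
  | add q r hq hr =>
    simp only [map_add, LinearMap.add_apply, mul_add] at hq hr ⊢
    rw [← hq, ← hr]
    abel
  | monomial j z =>
    have hpoly : Polynomial.C mu * Polynomial.X * Polynomial.monomial j z +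
        Polynomial.X ^ 2 * Polynomial.derivative (Polynomial.monomial j z) =
        Polynomial.monomial (j + 1) ((mu + j) * z) := by
      simp only [← Polynomial.C_mul_X_pow_eq_monomial, Polynomial.derivative_C_mul_X_pow]
      cases j with
      | zero => simp; ring
      | succ j => simp; ring
    rw [hpoly, raise_monomial, raise_monomial, invPoch_succ]
    simp only [LinearMap.smul_apply, map_smul, smul_smul]
    rw [pow_succ', Module.End.mul_apply]
    -- Here cancellation fails. It happens only for $\mu=0$ and $j=0$, where both sides vanish since
    -- $ep=0$.
    by_cases hj : mu + j = 0
    · cases j with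
      | zero =>
        have : mu = 0 := by simpa using hj
        simp [h0 this]
      | succ j => exact absurd hj (hmu j)
    · congr 1
      field_simp

theorem raise_gH (hhe : ∀ m, h (e m) = e (h m) + (2 : ℂ) • e m) (hp : h p = mu • p) (q : ℂ[X]) :
    raise e mu (Polynomial.C mu * q + 2 * Polynomial.X * Polynomial.derivative q) p =
      h (raise e mu q p) := by
  induction q using Polynomial.induction_on' with
  | add q r hq hr =>
    simp only [map_add, LinearMap.add_apply, mul_add] at hq hr ⊢
    rw [← hq, ← hr]
    abel
  | monomial j z =>
    have hpoly : Polynomial.C mu * Polynomial.monomial j z +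
        2 * Polynomial.X * Polynomial.derivative (Polynomial.monomial j z) =
        Polynomial.monomial j ((mu + 2 * j) * z) := by
      simp only [← Polynomial.C_mul_X_pow_eq_monomial, Polynomial.derivative_C_mul_X_pow]
      rw [← Polynomial.C_ofNat]
      cases j with
      | zero => simp
      | succ j => simp; ring
    rw [hpoly, raise_monomial, raise_monomial]
    simp only [LinearMap.smul_apply, map_smul, smul_smul, weight_pow hhe hp]
    congr 1
    ring

theorem raise_gF (hhe : ∀ m, h (e m) = e (h m) + (2 : ℂ) • e m)
    (hef : ∀ m, f (e m) = e (f m) - h m) (hf : f p = 0) (hp : h p = mu • p)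
    (hmu : ∀ j : ℕ, mu + j ≠ 0) (q : ℂ[X]) :
    raise e mu (Polynomial.derivative q) p = -f (raise e mu q p) := by
  induction q using Polynomial.induction_on' with
  | add q r hq hr =>
    simp only [map_add, LinearMap.add_apply] at hq hr ⊢
    rw [hq, hr]
    abel
  | monomial j z =>
    rw [Polynomial.derivative_monomial, raise_monomial, raise_monomial]
    cases j with
    | zero => simp [hf]
    | succ j =>
      simp only [LinearMap.smul_apply, map_smul, lower_pow_succ hhe hef hf hp, smul_smul, ← smul_neg,
        neg_smul, neg_neg, Nat.add_sub_cancel, invPoch_succ]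
      congr 1
      have := hmu j
      field_simp
      push_cast
      ring

/-- Pairing with $e^jw$ isolates the $j$-th coefficient of $q$. The normalisation $\mu'$ is kept
separate from the weight $\mu$ of $w$ because $p$ and $w$ may come from different summands. -/
theorem form_raise {β : M →ₗ[ℂ] M →ₗ⋆[ℂ] ℂ} (hsymm : ∀ p q, β q p = conj (β p q))
    (hhe : ∀ m, h (e m) = e (h m) + (2 : ℂ) • e m) (hef : ∀ m, f (e m) = e (f m) - h m)
    (hβ : ∀ p q, β (e p) q = -β p (f q)) (hfp : f p = 0) (hfw : f w = 0) (hw : h w = mu • w)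
    (j : ℕ) (q : ℂ[X]) : β (raise e mu' q p) ((e ^ j) w) =
      invPoch mu' j * normFactor mu j * β (q.coeff j • p) w := by
  induction q using Polynomial.induction_on' with
  | add q r hq hr =>
    simp only [map_add, LinearMap.add_apply, hq, hr, Polynomial.coeff_add, add_smul, mul_add]
  | monomial k z =>
    simp only [raise_monomial, LinearMap.smul_apply, map_smul,
      form_pow_pow hsymm hhe hef hβ hfp hfw hw, Polynomial.coeff_monomial]
    by_cases hk : k = j
    · subst hk
      simp only [if_true, smul_eq_mul]
      ring
    · simp [hk]

/-- $\|ep\|^2=-\beta(p,fep)=\bar\mu\,\|p\|^2$, and both norms are real, the first nonnegative and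
the second positive. -/
theorem weight_nonneg {β : M →ₗ[ℂ] M →ₗ⋆[ℂ] ℂ} (hsymm : ∀ p q, β q p = conj (β p q))
    (hpos : ∀ p, p ≠ 0 → 0 < (β p p).re) (hef : ∀ m, f (e m) = e (f m) - h m)
    (hβ : ∀ p q, β (e p) q = -β p (f q)) (hf : f p = 0) (hp : h p = mu • p) (h0 : p ≠ 0) :
    ∃ r : ℝ, 0 ≤ r ∧ mu = r := by
  have key : β (e p) (e p) = conj mu * β p p := by
    rw [hβ, hef, hf, hp, map_zero, zero_sub, map_neg, neg_neg, map_smulₛₗ, smul_eq_mul]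
  have hreal : ∀ q, β q q = ((β q q).re : ℂ) := fun q =>
    (Complex.conj_eq_iff_re.mp (hsymm q q).symm).symm
  have hp0 := hpos p h0
  have hnn : 0 ≤ (β (e p) (e p)).re := by
    by_cases he : e p = 0
    · simp [he]
    · exact (hpos _ he).le
  refine ⟨(β (e p) (e p)).re / (β p p).re, div_nonneg hnn hp0.le, ?_⟩
  have h1 : conj mu = (((β (e p) (e p)).re / (β p p).re : ℝ) : ℂ) := by
    rw [Complex.ofReal_div, ← hreal, ← hreal, key, mul_div_cancel_right₀]
    intro h
    rw [h] at hp0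
    simp at hp0
  rw [← Complex.conj_conj mu, h1, Complex.conj_ofReal]

theorem raise_eq_zero_of_weight_zero {β : M →ₗ[ℂ] M →ₗ⋆[ℂ] ℂ}
    (hpos : ∀ p, p ≠ 0 → 0 < (β p p).re) (hef : ∀ m, f (e m) = e (f m) - h m)
    (hβ : ∀ p q, β (e p) q = -β p (f q)) (hf : f p = 0) (hp : h p = mu • p) (hmu : mu = 0) :
    e p = 0 := by
  refine eq_zero_of_form_self hpos ?_
  rw [hβ, hef, hf, hp, hmu]
  simp

end LowestWeightVectors

/-! ### Coefficients in lowest weight modules -/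

section Coefficients

/-- The polynomial that an element of `L(mu, nu)` is. -/
def lowPoly {mu nu : ℂ} : LowestWeight mu nu →ₗ[ℂ] ℂ[X] where
  toFun l := l.1
  map_add' _ _ := rfl
  map_smul' _ _ := rfl

theorem lowPoly_injective {mu nu : ℂ} : Function.Injective (lowPoly (mu := mu) (nu := nu)) :=
  Subtype.val_injective

theorem lowPoly_lie {mu nu : ℂ} (X : GL2) (l : LowestWeight mu nu) :
    lowPoly ⁅X, l⁆ = polyAct mu nu X (lowPoly l) := rfl

theorem lowestWeight_zero_coeff (nu : ℂ) (l : LowestWeight 0 nu) {j : ℕ} (hj : j ≠ 0) :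
    (lowPoly l).coeff j = 0 := by
  -- For $\mu=0$ the constants form a submodule, so the span of $1$ contains nothing else.
  let K : LieSubmodule ℂ GL2 (PolyModel 0 nu) :=
    { toSubmodule := LinearMap.range (Polynomial.CAlgHom (R := ℂ) (A := ℂ)).toLinearMap
      lie_mem := by
        rintro A _ ⟨z, rfl⟩
        refine ⟨(A 0 0 + A 1 1) / 2 * (nu * z), ?_⟩
        change Polynomial.C _ = polyAct 0 nu A (Polynomial.C z)
        simp [polyAct] }
  have hK : LieSubmodule.lieSpan ℂ GL2 {polyOne 0 nu} ≤ K := by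
    rw [LieSubmodule.lieSpan_le, Set.singleton_subset_iff]
    exact ⟨1, Polynomial.C_1⟩
  obtain ⟨z, hz⟩ := hK l.2
  have hl : lowPoly l = Polynomial.C z := hz.symm
  rw [hl]
  exact Polynomial.coeff_C_of_ne_zero hj

variable {U : Type*} [AddCommGroup U] [Module ℂ U] {mu nu : ℂ}

variable (mu nu) in
/-- The `j`-th coefficient of an element of `L(mu, nu)`. -/
def lowCoeff (j : ℕ) : LowestWeight mu nu →ₗ[ℂ] ℂ := Polynomial.lcoeff ℂ j ∘ₗ lowPoly

variable (U mu nu) in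
/-- The map `u ⊗ l ↦ l_j u`, with `l_j` the `j`-th coefficient of `l`. -/
def tensorCoeff (j : ℕ) : U ⊗[ℂ] LowestWeight mu nu →ₗ[ℂ] U :=
  (TensorProduct.rid ℂ U).toLinearMap ∘ₗ (lowCoeff mu nu j).lTensor U

theorem tensorCoeff_tmul (j : ℕ) (u : U) (l : LowestWeight mu nu) :
    tensorCoeff U mu nu j (u ⊗ₜ l) = (lowPoly l).coeff j • u := by
  simp only [tensorCoeff, LinearMap.comp_apply, LinearMap.lTensor_tmul, LinearEquiv.coe_coe,
    TensorProduct.rid_tmul]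
  rfl

/-- After expanding in a basis of $U$, a tensor is a finite family of polynomials, each determined
by its coefficients. -/
theorem eq_of_tensorCoeff {t t' : U ⊗[ℂ] LowestWeight mu nu}
    (ht : ∀ j, tensorCoeff U mu nu j t = tensorCoeff U mu nu j t') : t = t' := by
  classical
  let B := Module.Basis.ofVectorSpace ℂ U
  apply (TensorProduct.equivFinsuppOfBasisLeft B).injective
  ext i : 1
  refine lowPoly_injective (Polynomial.ext fun j => ?_)
  have key : ∀ t : U ⊗[ℂ] LowestWeight mu nu, lowCoeff mu nu j
      (TensorProduct.equivFinsuppOfBasisLeft B t i) = B.repr (tensorCoeff U mu nu j t) i := by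
    intro t
    induction t using TensorProduct.induction_on with
    | zero => simp
    | tmul u l =>
      rw [TensorProduct.equivFinsuppOfBasisLeft_apply_tmul_apply, tensorCoeff_tmul, map_smul,
        map_smul, Finsupp.smul_apply, smul_eq_mul, smul_eq_mul, mul_comm]
      rfl
    | add a b ha hb => simp only [map_add, Finsupp.add_apply, ha, hb]
  have := (key t).trans ((congrArg (fun u => B.repr u i) (ht j)).trans (key t').symm)
  exact this

theorem tensorCoeff_weight_zero (hmu : mu = 0) {j : ℕ} (hj : j ≠ 0)
    (t : U ⊗[ℂ] LowestWeight mu nu) : tensorCoeff U mu nu j t = 0 := by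
  subst hmu
  induction t using TensorProduct.induction_on with
  | zero => simp
  | tmul u l => rw [tensorCoeff_tmul, lowestWeight_zero_coeff nu l hj, zero_smul]
  | add a b ha hb => rw [map_add, ha, hb, add_zero]

end Coefficients

/-! ### The intertwining property for all of $\mathfrak{gl}(2,\mathbb C)$ -/

section RaiseLie

variable {M : Type*} [AddCommGroup M] [Module ℂ M] {e f h z : Module.End ℂ M} {mu nu : ℂ} {p : M}

theorem raise_lie (hhe : ∀ m, h (e m) = e (h m) + (2 : ℂ) • e m)
    (hef : ∀ m, f (e m) = e (f m) - h m) (hze : ∀ m, z (e m) = e (z m)) (hf : f p = 0)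
    (hp : h p = mu • p) (hz : z p = nu • p) (h0 : mu = 0 → e p = 0)
    (hmu : ∀ j : ℕ, mu + (j + 1 : ℕ) ≠ 0) (X : GL2) (l : LowestWeight mu nu) :
    raise e mu (lowPoly ⁅X, l⁆) p = ((X 0 0 - X 1 1) / 2) • h (raise e mu (lowPoly l) p) +
      X 0 1 • e (raise e mu (lowPoly l) p) + X 1 0 • f (raise e mu (lowPoly l) p) +
      ((X 0 0 + X 1 1) / 2) • z (raise e mu (lowPoly l) p) := by
  have hE := raise_gE h0 hmu (lowPoly l)
  have hH := raise_gH hhe hp (lowPoly l)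
  have hZ := raise_comm (mu := mu) hze (lowPoly l) p
  rw [hz, map_smul] at hZ
  have hF : raise e mu (Polynomial.derivative (lowPoly l)) p =
      -f (raise e mu (lowPoly l) p) := by
    -- At $\mu=0$ the lowering identity would need a division by $\mu$; there $l$ is constant and
    -- both sides vanish.
    by_cases hm : mu = 0
    · subst hm
      have hl : (lowPoly l) = Polynomial.C ((lowPoly l).coeff 0) := by
        ext j
        cases j with
        | zero => simp
        | succ j =>
          rw [Polynomial.coeff_C_succ]
          exact lowestWeight_zero_coeff _ l j.succ_ne_zero
      rw [hl, raise_C, Polynomial.derivative_C]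
      simp [hf]
    · refine raise_gF hhe hef hf hp (fun j => ?_) _
      cases j with
      | zero => simpa using hm
      | succ j => exact hmu j
  rw [lowPoly_lie]
  generalize lowPoly l = q at *
  simp only [polyAct, ← Polynomial.smul_eq_C_mul] at hE hH ⊢
  rw [map_add, map_sub, map_add, map_smul, map_smul, map_smul, map_smul, map_smul]
  simp only [LinearMap.add_apply, LinearMap.sub_apply, LinearMap.smul_apply]
  rw [hE, hH, hF, hZ, smul_neg, sub_neg_eq_add]

end RaiseLie

/-! ### Direct sums of tensor products -/

section DirectSum

variable {ι : Type*} [DecidableEq ι] {A B : ι → Type*} [∀ i, AddCommGroup (A i)]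
  [∀ i, Module ℂ (A i)] [∀ i, AddCommGroup (B i)] [∀ i, Module ℂ (B i)]

theorem directSum_tensor_induction {P : (⨁ i, A i ⊗[ℂ] B i) → Prop} (zero : P 0)
    (pure : ∀ i a b, P (DirectSum.lof ℂ ι (fun i => A i ⊗[ℂ] B i) i (a ⊗ₜ b)))
    (add : ∀ d d', P d → P d' → P (d + d')) (d : ⨁ i, A i ⊗[ℂ] B i) : P d := by
  induction d using DirectSum.induction_on with
  | zero => exact zero
  | of i x =>
    induction x using TensorProduct.induction_on with
    | zero => rw [map_zero]; exact zero
    | tmul a b => exact pure i a b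
    | add x y hx hy => rw [map_add]; exact add _ _ hx hy
  | add x y hx hy => exact add _ _ hx hy

theorem lof_tmul_apply_self (i : ι) (a : A i) (b : B i) :
    DirectSum.lof ℂ ι (fun i => A i ⊗[ℂ] B i) i (a ⊗ₜ b) i = a ⊗ₜ b :=
  DirectSum.of_eq_same i _

theorem lof_tmul_apply_of_ne {i j : ι} (hij : i ≠ j) (a : A i) (b : B i) :
    DirectSum.lof ℂ ι (fun i => A i ⊗[ℂ] B i) i (a ⊗ₜ b) j = 0 :=
  DirectSum.of_eq_of_ne i j _ hij.symm

end DirectSum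

/-! ### The joint decomposition of the standard module -/

section Decomposition

variable {E : Type*} [NormedAddCommGroup E] [InnerProductSpace ℝ E] [FiniteDimensional ℝ E]
variable {G : Subgroup (E ≃ₗᵢ[ℝ] E)} [Finite G] {c : Refl G → ℝ}
variable {n : ℕ} {b : OrthonormalBasis (Fin n ⊕ Fin n) ℝ E}
variable {V : Type*} [AddCommGroup V] [Module ℂ V] {τ : Representation ℂ G V} {N : ℂ}

/-! #### The operators on the standard module -/

theorem act_Hel_Eplus (m : StdModule c τ) : act c τ (Hel G c b) (act c τ (Eplus G c b) m) =
    act c τ (Eplus G c b) (act c τ (Hel G c b) m) + (2 : ℂ) • act c τ (Eplus G c b) m := by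
  have h := congrArg (fun x : RCA G c => act c τ x m) (lie_Hel_Eplus (G := G) (c := c) b)
  simp only [Ring.lie_def, map_sub, map_mul, map_smul, LinearMap.sub_apply, LinearMap.smul_apply,
    Module.End.mul_apply] at h
  rw [← h]
  abel

theorem act_Eminus_Eplus (m : StdModule c τ) : act c τ (Eminus G c b) (act c τ (Eplus G c b) m) =
    act c τ (Eplus G c b) (act c τ (Eminus G c b) m) - act c τ (Hel G c b) m := by
  have h := congrArg (fun x : RCA G c => act c τ x m) (lie_Eplus_Eminus (G := G) (c := c) b)
  simp only [Ring.lie_def, map_sub, map_mul, LinearMap.sub_apply, Module.End.mul_apply] at h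
  rw [← h]
  abel

theorem act_commute {h h' : RCA G c} (hh : Commute h h') (m : StdModule c τ) :
    act c τ h (act c τ h' m) = act c τ h' (act c τ h m) := by
  have := congrArg (fun x : RCA G c => act c τ x m) hh.eq
  simpa only [map_mul, Module.End.mul_apply] using this

theorem harmEig_Eminus {k : ℕ} {lam : ℂ} {p : StdModule c τ} (hp : p ∈ harmEig c b τ k lam) :
    act c τ (Eminus G c b) p = 0 := hp.1.2

theorem harmEig_Zel {k : ℕ} {lam : ℂ} {p : StdModule c τ} (hp : p ∈ harmEig c b τ k lam) :
    act c τ (Zel G c b) p = lam • p := Module.End.mem_eigenspace_iff.mp hp.2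

theorem harmEig_Hel (hN : ∀ v : V, ∑ s : Refl G, (c s : ℂ) • τ s.1 v = N • v) {k : ℕ} {lam : ℂ}
    {p : StdModule c τ} (hp : p ∈ harmEig c b τ k lam) :
    act c τ (Hel G c b) p = ((k : ℂ) + n - N) • p := Hel_smul b hN hp.1.1

theorem centralizer_smul_mem_harmEig
    (hN : ∀ v : V, ∑ s : Refl G, (c s : ℂ) • τ s.1 v = N • v) {h : RCA G c}
    (hh : h ∈ centralizerV G c b) (k : ℕ) (lam : ℂ) {p : StdModule c τ}
    (hp : p ∈ harmEig c b τ k lam) : h • p ∈ harmEig c b τ k lam := by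
  rw [centralizerV, Subalgebra.mem_centralizer_iff] at hh
  have hF : Commute (Eminus G c b) h := hh _ (by simp)
  have hH : Commute (Hel G c b) h := hh _ (by simp)
  have hZ : Commute (Zel G c b) h := hh _ (by simp)
  refine ⟨⟨?_, ?_⟩, ?_⟩
  · rw [degPart_eq_eigenspace b hN]
    refine Module.End.mem_eigenspace_iff.mpr ?_
    change act c τ _ (act c τ h p) = _ • act c τ h p
    rw [act_commute hH, harmEig_Hel hN hp, map_smul]
  · change act c τ _ (act c τ h p) = 0
    rw [act_commute hF, harmEig_Eminus hp, map_zero]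
  · refine Module.End.mem_eigenspace_iff.mpr ?_
    change act c τ _ (act c τ h p) = _ • act c τ h p
    rw [act_commute hZ, harmEig_Zel hp, map_smul]

/-! #### The decomposition map -/

variable (c b τ N) in
/-- The map `p ⊗ l ↦ l(E₊) p`, with `l(E₊)` the normalised polynomial in `E₊`. -/
def summandMap (i : SpecIdx c b τ) : Summand c b τ N i →ₗ[ℂ] StdModule c τ :=
  TensorProduct.lift ((((raise (act c τ (Eplus G c b)) ((i.1 : ℂ) + n - N)) ∘ₗ lowPoly).flip) ∘ₗ
      (harmEig c b τ i.1 i.2).subtype)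

theorem summandMap_tmul (i : SpecIdx c b τ) (p : harmEig c b τ i.1 i.2)
    (l : LowestWeight ((i.1 : ℂ) + n - N) i.2) :
    summandMap c b τ N i (p ⊗ₜ l) =
      raise (act c τ (Eplus G c b)) ((i.1 : ℂ) + n - N) (lowPoly l) (p : StdModule c τ) := rfl

open Classical in
variable (c b τ N) in
/-- The map from the direct sum of the spaces `ℋ_c(τ)_{k,lam} ⊗ L(k + n - N, lam)` to `M_c(τ)`. -/
def decompMap : DecompSpace c b τ N →ₗ[ℂ] StdModule c τ :=
  DirectSum.toModule ℂ (SpecIdx c b τ) (StdModule c τ) (summandMap c b τ N)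

theorem decompMap_pureVec (i : SpecIdx c b τ) (p : harmEig c b τ i.1 i.2)
    (l : LowestWeight ((i.1 : ℂ) + n - N) i.2) : decompMap c b τ N (pureVec c b τ N i p l) =
      raise (act c τ (Eplus G c b)) ((i.1 : ℂ) + n - N) (lowPoly l) (p : StdModule c τ) := by
  classical
  rw [decompMap, pureVec, DirectSum.toModule_lof, summandMap_tmul]

theorem decompMap_lowVec (i : SpecIdx c b τ) (p : harmEig c b τ i.1 i.2) :
    decompMap c b τ N (pureVec c b τ N i p (lowVec _ _)) = p := by
  rw [decompMap_pureVec, show lowPoly (lowVec ((i.1 : ℂ) + n - N) i.2) = 1 from rfl, raise_one]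
  rfl

theorem decompMap_centralizer {h : RCA G c} (hh : h ∈ centralizerV G c b) (i : SpecIdx c b τ)
    (p : harmEig c b τ i.1 i.2) (hp : h • (p : StdModule c τ) ∈ harmEig c b τ i.1 i.2)
    (l : LowestWeight ((i.1 : ℂ) + n - N) i.2) :
    decompMap c b τ N (pureVec c b τ N i ⟨h • (p : StdModule c τ), hp⟩ l) =
      h • decompMap c b τ N (pureVec c b τ N i p l) := by
  rw [decompMap_pureVec, decompMap_pureVec]
  rw [centralizerV, Subalgebra.mem_centralizer_iff] at hh
  have hE : Commute (Eplus G c b) h := hh _ (by simp)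
  exact raise_comm (g := act c τ h) (act_commute hE.symm) _ _

theorem decompSpace_induction {P : DecompSpace c b τ N → Prop} (zero : P 0)
    (pure : ∀ i p l, P (pureVec c b τ N i p l)) (add : ∀ d d', P d → P d' → P (d + d'))
    (d : DecompSpace c b τ N) : P d :=
  directSum_tensor_induction zero pure add d

variable {β : StdModule c τ →ₗ[ℂ] StdModule c τ →ₗ⋆[ℂ] ℂ}

theorem form_Eplus (hβ : ∀ (h : RCA G c) (p q : StdModule c τ), β (h • p) q = β p (adj h • q))
    (p q : StdModule c τ) :
    β (act c τ (Eplus G c b) p) q = -β p (act c τ (Eminus G c b) q) := by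
  change β (Eplus G c b • p) q = -β p (Eminus G c b • q)
  rw [hβ, adj_Eplus, neg_smul, map_neg]

theorem weight_eq_ofReal
    (hN : ∀ v : V, ∑ s : Refl G, (c s : ℂ) • τ s.1 v = N • v)
    (hsymm : ∀ p q, β q p = conj (β p q)) (hpos : ∀ p, p ≠ 0 → 0 < (β p p).re)
    (hβ : ∀ (h : RCA G c) (p q : StdModule c τ), β (h • p) q = β p (adj h • q))
    (i : SpecIdx c b τ) : ∃ r : ℝ, 0 ≤ r ∧ (i.1 : ℂ) + n - N = r := by
  obtain ⟨p, hp, h0⟩ := Submodule.exists_mem_ne_zero_of_ne_bot i.2.2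
  exact weight_nonneg hsymm hpos act_Eminus_Eplus (form_Eplus hβ) (harmEig_Eminus hp)
    (harmEig_Hel hN hp) h0

theorem weight_add_succ_ne_zero
    (hN : ∀ v : V, ∑ s : Refl G, (c s : ℂ) • τ s.1 v = N • v)
    (hsymm : ∀ p q, β q p = conj (β p q)) (hpos : ∀ p, p ≠ 0 → 0 < (β p p).re)
    (hβ : ∀ (h : RCA G c) (p q : StdModule c τ), β (h • p) q = β p (adj h • q))
    (i : SpecIdx c b τ) (j : ℕ) :
    (i.1 : ℂ) + n - N + (j + 1 : ℕ) ≠ 0 := by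
  obtain ⟨r, hr, h⟩ := weight_eq_ofReal hN hsymm hpos hβ i
  rw [h]
  have : (0 : ℝ) < r + (j + 1 : ℕ) := by positivity
  exact_mod_cast this.ne'

theorem weight_add_ne_zero
    (hN : ∀ v : V, ∑ s : Refl G, (c s : ℂ) • τ s.1 v = N • v)
    (hsymm : ∀ p q, β q p = conj (β p q)) (hpos : ∀ p, p ≠ 0 → 0 < (β p p).re)
    (hβ : ∀ (h : RCA G c) (p q : StdModule c τ), β (h • p) q = β p (adj h • q))
    (i : SpecIdx c b τ) (hi : (i.1 : ℂ) + n - N ≠ 0) (j : ℕ) :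
    (i.1 : ℂ) + n - N + j ≠ 0 := by
  cases j with
  | zero => simpa using hi
  | succ j => exact weight_add_succ_ne_zero hN hsymm hpos hβ i j

/-- Eigenvectors of a self-adjoint operator for distinct real eigenvalues are orthogonal. $H$
separates different degrees, and $Z_0$ separates different $\lambda$ within one degree. -/
theorem form_harmEig_of_ne
    (hN : ∀ v : V, ∑ s : Refl G, (c s : ℂ) • τ s.1 v = N • v)
    (hsymm : ∀ p q, β q p = conj (β p q)) (hpos : ∀ p, p ≠ 0 → 0 < (β p p).re)
    (hβ : ∀ (h : RCA G c) (p q : StdModule c τ), β (h • p) q = β p (adj h • q))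
    {i i' : SpecIdx c b τ} (hi : i ≠ i') {p w : StdModule c τ}
    (hp : p ∈ harmEig c b τ i.1 i.2) (hw : w ∈ harmEig c b τ i'.1 i'.2) : β p w = 0 := by
  have ortho : ∀ (x : RCA G c) (z z' : ℂ), adj x = x → act c τ x p = z • p → act c τ x w = z' • w →
      conj z' ≠ z → β p w = 0 := by
    intro x z z' hx h1 h2 h3
    have e : β (x • p) w = β p (x • w) := by rw [hβ, hx]
    have h1' : x • p = z • p := h1
    have h2' : x • w = z' • w := h2
    rw [h1', h2', map_smul, map_smulₛₗ, LinearMap.smul_apply, smul_eq_mul, smul_eq_mul] at e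
    have : (conj z' - z) * β p w = 0 := by linear_combination -e
    exact (mul_eq_zero.mp this).resolve_left (sub_ne_zero.mpr h3)
  by_cases hw0 : w = 0
  · rw [hw0, map_zero]
  by_cases hk : i.1 = i'.1
  · refine ortho _ _ _ (adj_Zel b) (harmEig_Zel hp) (harmEig_Zel hw) fun h => hi ?_
    have hreal : conj (i'.2 : ℂ) = i'.2 := by
      have e : β (Zel G c b • w) w = β w (Zel G c b • w) := by rw [hβ, adj_Zel]
      have h2' : Zel G c b • w = (i'.2 : ℂ) • w := harmEig_Zel hw
      rw [h2', map_smul, map_smulₛₗ, LinearMap.smul_apply, smul_eq_mul, smul_eq_mul] at e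
      refine mul_right_cancel₀ (fun h0 => hw0 (eq_zero_of_form_self hpos h0)) e.symm
    rw [hreal] at h
    obtain ⟨k, lam⟩ := i
    obtain ⟨k', lam'⟩ := i'
    obtain rfl : k = k' := hk
    obtain rfl : lam = lam' := Subtype.ext h.symm
    rfl
  · refine ortho _ _ _ (adj_Hel b) (harmEig_Hel hN hp) (harmEig_Hel hN hw) fun h => hk ?_
    obtain ⟨r, -, hr⟩ := weight_eq_ofReal hN hsymm hpos hβ i'
    rw [hr, Complex.conj_ofReal, ← hr] at h
    have : (i.1 : ℂ) = i'.1 := by linear_combination -h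
    exact_mod_cast this

/-- Orthogonality of the spaces $\mathcal H_{k,\lambda}$ removes every component except the one with
index $i$, and `form_raise` extracts its $j$-th coefficient. -/
theorem form_decompMap
    (hN : ∀ v : V, ∑ s : Refl G, (c s : ℂ) • τ s.1 v = N • v)
    (hsymm : ∀ p q, β q p = conj (β p q)) (hpos : ∀ p, p ≠ 0 → 0 < (β p p).re)
    (hβ : ∀ (h : RCA G c) (p q : StdModule c τ), β (h • p) q = β p (adj h • q))
    (i : SpecIdx c b τ) {w : StdModule c τ} (hw : w ∈ harmEig c b τ i.1 i.2)
    (j : ℕ) (d : DecompSpace c b τ N) :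
    β (decompMap c b τ N d) ((act c τ (Eplus G c b) ^ j) w) =
      invPoch ((i.1 : ℂ) + n - N) j * normFactor ((i.1 : ℂ) + n - N) j *
        β (tensorCoeff _ _ _ j (d i) : harmEig c b τ i.1 i.2) w := by
  classical
  induction d using decompSpace_induction with
  | zero => simp
  | pure i' p l =>
    rw [decompMap_pureVec, form_raise hsymm act_Hel_Eplus act_Eminus_Eplus (form_Eplus hβ)
      (harmEig_Eminus p.2) (harmEig_Eminus hw) (harmEig_Hel hN hw)]
    by_cases hi : i' = i
    · subst hi
      have h1 : pureVec c b τ N i' p l i' = p ⊗ₜ l := by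
        exact lof_tmul_apply_self (A := fun i : SpecIdx c b τ => harmEig c b τ i.1 i.2)
          (B := fun i : SpecIdx c b τ => LowestWeight ((i.1 : ℂ) + n - N) i.2) i' p l
      rw [h1, tensorCoeff_tmul]
      rfl
    · have h1 : pureVec c b τ N i' p l i = 0 := by
        exact lof_tmul_apply_of_ne (A := fun i : SpecIdx c b τ => harmEig c b τ i.1 i.2)
          (B := fun i : SpecIdx c b τ => LowestWeight ((i.1 : ℂ) + n - N) i.2) hi p l
      have h2 := form_harmEig_of_ne hN hsymm hpos hβ hi p.2 hw
      rw [h1, map_smul, LinearMap.smul_apply, h2]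
      simp
  | add d d' h h' =>
    rw [map_add, map_add, LinearMap.add_apply, h, h', DirectSum.add_apply, map_add,
      Submodule.coe_add, map_add, LinearMap.add_apply, mul_add]

theorem decompMap_injective
    (hN : ∀ v : V, ∑ s : Refl G, (c s : ℂ) • τ s.1 v = N • v)
    (hsymm : ∀ p q, β q p = conj (β p q)) (hpos : ∀ p, p ≠ 0 → 0 < (β p p).re)
    (hβ : ∀ (h : RCA G c) (p q : StdModule c τ), β (h • p) q = β p (adj h • q))
    : Function.Injective (decompMap c b τ N) := by
  intro d d' hd
  refine DFinsupp.ext fun i => eq_of_tensorCoeff fun j => ?_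
  -- The one case in which the norm factor vanishes; there $L(0,\lambda)$ has no coefficients of
  -- positive degree.
  by_cases hj : (i.1 : ℂ) + n - N = 0 ∧ j ≠ 0
  · exact (tensorCoeff_weight_zero hj.1 hj.2 _).trans (tensorCoeff_weight_zero hj.1 hj.2 _).symm
  have hne : ∀ k < j, (i.1 : ℂ) + n - N + k ≠ 0 := fun k hk =>
    weight_add_ne_zero hN hsymm hpos hβ i (fun h => hj ⟨h, by omega⟩) k
  have h1 : invPoch ((i.1 : ℂ) + n - N) j ≠ 0 :=
    Finset.prod_ne_zero_iff.mpr fun k hk => inv_ne_zero (hne k (Finset.mem_range.mp hk))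
  have h2 : normFactor ((i.1 : ℂ) + n - N) j ≠ 0 :=
    Finset.prod_ne_zero_iff.mpr fun k hk => mul_ne_zero (by exact_mod_cast k.succ_ne_zero)
      ((map_ne_zero _).mpr (hne k (Finset.mem_range.mp hk)))
  set u : harmEig c b τ i.1 i.2 := tensorCoeff _ _ _ j (d i)
  set u' : harmEig c b τ i.1 i.2 := tensorCoeff _ _ _ j (d' i)
  -- Testing against $w=u-u'$ makes equality of the two pairings say $\beta(u-u',u-u')=0$.
  have h3 := form_decompMap hN hsymm hpos hβ i (u - u').2 j d
  have h4 := form_decompMap hN hsymm hpos hβ i (u - u').2 j d'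
  rw [hd, h4] at h3
  have h5 := mul_left_cancel₀ (mul_ne_zero h1 h2) h3
  refine Subtype.ext (sub_eq_zero.mp (eq_zero_of_form_self hpos ?_))
  exact (LinearMap.map_sub₂ β _ _ _).trans (sub_eq_zero.mpr h5.symm)

theorem decompMap_lie
    (hN : ∀ v : V, ∑ s : Refl G, (c s : ℂ) • τ s.1 v = N • v)
    (hsymm : ∀ p q, β q p = conj (β p q)) (hpos : ∀ p, p ≠ 0 → 0 < (β p p).re)
    (hβ : ∀ (h : RCA G c) (p q : StdModule c τ), β (h • p) q = β p (adj h • q))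
    (X : GL2) (i : SpecIdx c b τ) (p : harmEig c b τ i.1 i.2)
    (l : LowestWeight ((i.1 : ℂ) + n - N) i.2) :
    decompMap c b τ N (pureVec c b τ N i p ⁅X, l⁆) =
      gl2Hom G c b X • decompMap c b τ N (pureVec c b τ N i p l) := by
  rw [decompMap_pureVec, decompMap_pureVec]
  have h := raise_lie (e := act c τ (Eplus G c b)) act_Hel_Eplus act_Eminus_Eplus
    (act_commute (commute_Zel_Eplus b)) (harmEig_Eminus p.2) (harmEig_Hel hN p.2) (harmEig_Zel p.2)
    (fun h0 => raise_eq_zero_of_weight_zero hpos act_Eminus_Eplus (form_Eplus hβ)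
      (harmEig_Eminus p.2) (harmEig_Hel hN p.2) h0)
    (weight_add_succ_ne_zero hN hsymm hpos hβ i) X l
  rw [h, gl2Hom_apply]
  simp only [add_smul, smul_assoc]
  rfl

theorem decompMap_surjective
    (hN : ∀ v : V, ∑ s : Refl G, (c s : ℂ) • τ s.1 v = N • v)
    (hsymm : ∀ p q, β q p = conj (β p q)) (hpos : ∀ p, p ≠ 0 → 0 < (β p p).re)
    (hβ : ∀ (h : RCA G c) (p q : StdModule c τ), β (h • p) q = β p (adj h • q))
    [FiniteDimensional ℂ V] :
    Function.Surjective (decompMap c b τ N) := by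
  rw [← LinearMap.range_eq_top, eq_top_iff, ← iSup_degPart]
  refine iSup_le fun k => ?_
  -- The range is closed under $E_+$ because the action of $E_+$ lifts to the second tensor factors.
  -- It then suffices that it contains the harmonics.
  have hE : ∀ m ∈ LinearMap.range (decompMap c b τ N),
      act c τ (Eplus G c b) m ∈ LinearMap.range (decompMap c b τ N) := by
    rintro _ ⟨d, rfl⟩
    induction d using decompSpace_induction with
    | zero => rw [map_zero, map_zero]; exact zero_mem _
    | pure i p l =>
      refine ⟨pureVec c b τ N i p ⁅gE, l⁆, ?_⟩
      rw [decompMap_lie hN hsymm hpos hβ, gl2Hom_gE]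
      rfl
    | add d d' h h' => rw [map_add, map_add]; exact add_mem h h'
  have hharm : ∀ k, harm c b τ k ≤ LinearMap.range (decompMap c b τ N) := by
    intro k
    have := finiteDimensional_degPart (c := c) (τ := τ) k
    have : FiniteDimensional ℂ (harm c b τ k) := Submodule.finiteDimensional_of_le inf_le_left
    refine (le_iSup_inf_eigenspace hsymm hpos (harm c b τ k) (T := act c τ (Zel G c b))
      ?_ ?_).trans (iSup_le fun lam p hp => ?_)
    · intro p q
      change β (Zel G c b • p) q = β p (Zel G c b • q)
      rw [hβ, adj_Zel]
    · intro p hp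
      refine ⟨Zel_smul_mem b hp.1, ?_⟩
      change act c τ _ (act c τ _ p) = 0
      rw [← act_commute (commute_Zel_Eminus b), show act c τ (Eminus G c b) p = 0 from hp.2,
        map_zero]
    · change p ∈ harmEig c b τ k lam at hp
      -- The supremum runs over all complex numbers, but only those with nonzero eigenspace index a
      -- summand.
      by_cases hs : harmEig c b τ k lam = ⊥
      · rw [hs, Submodule.mem_bot] at hp
        rw [hp]
        exact zero_mem _
      · refine ⟨pureVec c b τ N ⟨k, lam, hs⟩ ⟨p, hp⟩ (lowVec _ _), ?_⟩
        exact decompMap_lowVec _ _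
  induction k using Nat.strong_induction_on with
  | _ k ih =>
    intro p hp
    -- $E_-$ lowers the degree by two, so degrees $0$ and $1$ are entirely harmonic.
    rcases lt_or_ge k 2 with hk | hk
    · exact hharm k ⟨hp, Eminus_smul_eq_zero b hk hp⟩
    · obtain ⟨k, rfl⟩ := Nat.exists_eq_add_of_le' hk
      have := finiteDimensional_degPart (c := c) (τ := τ) k
      obtain ⟨w, ⟨r, hr, rfl⟩, hw⟩ := exists_mem_orthogonal hsymm hpos
        ((degPart c τ k).map (act c τ (Eplus G c b))) p
      set q := p - act c τ (Eplus G c b) r with hq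
      have hqk : q ∈ degPart c τ (k + 2) := sub_mem hp (Eplus_smul_mem b hr)
      -- $q$ is orthogonal to $E_+M_k$, which contains $E_+E_-q$; hence
      -- $\|E_-q\|^2=-\beta(E_+E_-q,q)=0$.
      have hqF : act c τ (Eminus G c b) q = 0 := by
        refine eq_zero_of_form_self hpos ?_
        have h1 := hw _ ⟨_, Eminus_smul_mem b hqk, rfl⟩
        have h2 := form_Eplus (b := b) hβ (act c τ (Eminus G c b) q) q
        rw [hsymm] at h1
        have h3 : β (act c τ (Eplus G c b) (act c τ (Eminus G c b) q)) q = 0 :=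
          (map_eq_zero _).mp h1
        rw [h3] at h2
        exact neg_eq_zero.mp h2.symm
      have hp' : p = q + act c τ (Eplus G c b) r := by rw [hq, sub_add_cancel]
      rw [hp']
      exact add_mem (hharm _ ⟨hqk, hqF⟩) (hE _ (ih k (by omega) hr))

end Decomposition

end Cherednik

end

theorem mainTheorem9
    {E : Type*} [NormedAddCommGroup E] [InnerProductSpace ℝ E] [FiniteDimensional ℝ E]
    {n : ℕ} (J : E ≃ₗᵢ[ℝ] E) (hJ : Cherednik.IsComplexStructure J)
    (b : OrthonormalBasis (Fin n ⊕ Fin n) ℝ E) (hb : Cherednik.IsAdapted J b)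
    (G : Subgroup (E ≃ₗᵢ[ℝ] E)) [Finite G] (hG : Cherednik.IsReflectionGroup G)
    (c : Cherednik.Refl G → ℝ) (hc : Cherednik.IsClassParameter G c)
    {V : Type*} [AddCommGroup V] [Module ℂ V] (τ : Representation ℂ G V) (hτ : τ.IsIrreducible)
    (hirr : IsSimpleModule (Cherednik.RCA G c) (Cherednik.StdModule c τ))
    (hunit : Cherednik.IsUnitarisable c τ) :
    -- `N = N_c(τ)` is the scalar by which `σ` acts on `V(τ)`
    ∃ N : ℂ, (∀ v : V, ∑ s : Cherednik.Refl G, (c s : ℂ) • τ s.1 v = N • v) ∧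
    -- the realisation of `𝔲(1,1)` in `H_c(G, E)`
    ∃ ρ : Cherednik.GL2 →ₗ⁅ℂ⁆ Cherednik.RCA G c,
      (ρ Cherednik.gE = Cherednik.Eplus G c b ∧ ρ Cherednik.gF = Cherednik.Eminus G c b ∧
        ρ Cherednik.gH = Cherednik.Hel G c b ∧ ρ Cherednik.gZ = Cherednik.Zel G c b ∧
        ∀ X ∈ Cherednik.u11, Cherednik.adj (ρ X) = -ρ X) ∧
    -- the spaces `ℋ_c(τ)_{k,lam}` are modules over the centralizer `𝒱`
    ∃ hV : ∀ h ∈ Cherednik.centralizerV G c b, ∀ (k : ℕ) (lam : ℂ),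
        ∀ p ∈ Cherednik.harmEig c b τ k lam, h • p ∈ Cherednik.harmEig c b τ k lam,
    -- the joint decomposition
    ∃ Φ : Cherednik.DecompSpace c b τ N ≃ₗ[ℂ] Cherednik.StdModule c τ,
      (∀ (i : Cherednik.SpecIdx c b τ) (p : Cherednik.harmEig c b τ i.1 i.2),
        Φ (Cherednik.pureVec c b τ N i p (Cherednik.lowVec _ _)) = p) ∧
      (∀ (X : Cherednik.GL2) (i : Cherednik.SpecIdx c b τ) (p : Cherednik.harmEig c b τ i.1 i.2)
        (l : Cherednik.LowestWeight ((i.1 : ℂ) + n - N) i.2),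
        Φ (Cherednik.pureVec c b τ N i p ⁅X, l⁆) =
          ρ X • Φ (Cherednik.pureVec c b τ N i p l)) ∧
      (∀ (h : Cherednik.RCA G c) (hh : h ∈ Cherednik.centralizerV G c b)
        (i : Cherednik.SpecIdx c b τ) (p : Cherednik.harmEig c b τ i.1 i.2)
        (l : Cherednik.LowestWeight ((i.1 : ℂ) + n - N) i.2),
        Φ (Cherednik.pureVec c b τ N i ⟨h • (p : Cherednik.StdModule c τ),
            hV h hh i.1 i.2 p p.2⟩ l) =
          h • Φ (Cherednik.pureVec c b τ N i p l)) := by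
  have hfin : FiniteDimensional ℂ V := Cherednik.finiteDimensional_of_isIrreducible τ hτ
  obtain ⟨N, hN⟩ := Cherednik.exists_sigma_scalar hc hτ
  obtain ⟨β, hsymm, hpos, hβ⟩ := hunit
  refine ⟨N, hN, Cherednik.gl2Hom G c b, ⟨Cherednik.gl2Hom_gE G c b, Cherednik.gl2Hom_gF G c b,
    Cherednik.gl2Hom_gH G c b, Cherednik.gl2Hom_gZ G c b, fun X hX => Cherednik.adj_gl2Hom G c b hX⟩,
    fun h hh k lam p hp => Cherednik.centralizer_smul_mem_harmEig hN hh k lam hp,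
    LinearEquiv.ofBijective (Cherednik.decompMap c b τ N)
      ⟨Cherednik.decompMap_injective hN hsymm hpos hβ,
        Cherednik.decompMap_surjective hN hsymm hpos hβ⟩, ?_, ?_, ?_⟩
  · exact fun i p => Cherednik.decompMap_lowVec i p
  · exact fun X i p l => Cherednik.decompMap_lie hN hsymm hpos hβ X i p l
  · exact fun h hh i p l => Cherednik.decompMap_centralizer hh i p _ l
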